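/- Consider the coined discrete-time quantum walk on $\ell^2(\mathbb Z)\otimes\mathbb C^2$ with one-step operator $U=S(\mathbb 1\otimes C_{\theta,\alpha,\beta})$, where $S=\sum_x |x+1\rangle\langle x|\otimes|0\rangle\langle 0|+|x-1\rangle\langle x|\otimes|1\rangle\langle 1|$ and $$C_{\theta,\alpha,\beta}=\begin{pmatrix} e^{i\alpha}\cos\theta & e^{i\beta}\sin\theta\\ -e^{-i\beta}\sin\theta & e^{-i\alpha}\cos\theta\end{pmatrix},\qquad \theta,\alpha,\beta\in\mathbb R,\quad \sin\theta\ge 0 .$$ Let the initial state be localized, $\Psi(0)=|x_0\rangle\otimes|\chi\rangle$ with $x_0\in\mathbb Z$ and $\|\chi\|=1$, let $\vec r=(\langle\chi|\sigma_i|\chi\rangle)_{i=x,y,z}$ be the Bloch vector of $\chi$, and put $\phi=\alpha-\beta$ and $\hat n=(\sin\theta\cos\phi,\sin\theta\sin\phi,\cos\theta)$. Let $\varrho(t)=|\Psi(t)\rangle\langle\Psi(t)|$ with $\Psi(t)=U^t\Psi(0)$, regarded as a statistical model in the parameters $(\theta,\phi)$ with $\beta$ held fixed (so $\partial_\phi=\partial_\alpha$).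 Then for every $t$ the symmetric logarithmic derivatives $L_\theta,L_\phi$, defined by $\partial_\mu\varrho=\frac12\{L_\mu,\varrho\}$, exist, and the quantum Fisher information matrix $F_{\mu\nu}(t)=\frac12\mathrm{Tr}(\varrho\{L_\mu,L_\nu\})$ satisfies, to leading order as $t\to\infty$, $$\lim_{t\to\infty}\frac{F_{\theta\theta}(t)}{t^2}=\frac{4}{1+\sin\theta}\left(\sin\theta-\frac{(\hat n\times\vec r)_z^2}{1+\sin\theta}\right),\qquad \lim_{t\to\infty}\frac{F_{\phi\phi}(t)}{t^2}=4(1-\sin\theta)\left(1-\frac{(\hat n\cdot\vec r)^2}{1+\sin\theta}\right),$$ and, if $\cos\theta\neq0$, $$\lim_{t\to\infty}\frac{F_{\theta\phi}(t)}{t^2}=\frac{-4(1-\sin\theta)}{\cos\theta\,(1+\sin\theta)}\,(\hat n\cdot\vec r)\,(\hat n\times\vec r)_z .$$ In particular, a diagonal leading-order matrix is attainable: there is a unit vector $\chi$ with Bloch vector $\vec r=\partial_\theta\hat n$, and for every such $\chi$ (and every $x_0$) one has $F(t)/t^2\to\mathrm{diag}\left(\frac{4\sin\theta}{1+\sin\theta},\,4(1-\sin\theta)\right)$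 as $t\to\infty$. -/

import Mathlib

noncomputable section

open scoped ENNReal

/-- The coin space `ℂ²` with its orthonormal basis `|0⟩, |1⟩`. -/
abbrev CoinSpace : Type := EuclideanSpace ℂ (Fin 2)

/-- The lattice-coin space `ℓ²(ℤ) ⊗ ℂ²`, realised as `ℓ²(ℤ; ℂ²)`: the vector `Ψ x` collects the
amplitudes of `|x⟩ ⊗ |0⟩` and `|x⟩ ⊗ |1⟩`. -/
abbrev WalkSpace : Type := lp (fun _ : ℤ => CoinSpace) 2

/-- The product vector `|x⟩ ⊗ |χ⟩`. -/
def localizedState (x : ℤ) (χ : CoinSpace) : WalkSpace := lp.single 2 x χ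

/-- The coin operator `C_{θ,α,β}`. -/
def coinMatrix (θ α β : ℝ) : Matrix (Fin 2) (Fin 2) ℂ :=
  !![Complex.exp (Complex.I * α) * Real.cos θ, Complex.exp (Complex.I * β) * Real.sin θ;
     -(Complex.exp (-(Complex.I * β)) * Real.sin θ), Complex.exp (-(Complex.I * α)) * Real.cos θ]

/-- The operator `𝟙 ⊗ C` on the lattice-coin space, acting with `C` at every site. -/
def onCoin (C : Matrix (Fin 2) (Fin 2) ℂ) : WalkSpace →L[ℂ] WalkSpace :=
  lp.mapCLM 2 (fun _ : ℤ => Matrix.toEuclideanCLM (n := Fin 2) (𝕜 := ℂ) C)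
    (norm_nonneg (Matrix.toEuclideanCLM (n := Fin 2) (𝕜 := ℂ) C)) (fun _ => le_rfl)

theorem onCoin_apply (C : Matrix (Fin 2) (Fin 2) ℂ) (Ψ : WalkSpace) (x : ℤ) :
    onCoin C Ψ x = Matrix.toEuclideanCLM (n := Fin 2) (𝕜 := ℂ) C (Ψ x) := rfl

theorem memℓp_siteTranslate (n : ℤ) (Ψ : WalkSpace) :
    Memℓp (fun x : ℤ => (Ψ (x - n) : CoinSpace)) 2 := by
  have h2 : 0 < (2 : ℝ≥0∞).toReal := by norm_num
  exact memℓp_gen ((Equiv.subRight n).summable_iff.mpr ((lp.memℓp Ψ).summable h2))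

/-- Translation of the walker by `n` sites, `∑ₓ |x + n⟩⟨x| ⊗ 𝟙`. -/
def siteTranslate (n : ℤ) : WalkSpace →L[ℂ] WalkSpace :=
  LinearMap.mkContinuous
    { toFun := fun Ψ => (⟨fun x => Ψ (x - n), memℓp_siteTranslate n Ψ⟩ : WalkSpace)
      map_add' := fun _ _ => rfl
      map_smul' := fun _ _ => rfl } 1 (fun Ψ => by
    have h2 : 0 < (2 : ℝ≥0∞).toReal := by norm_num
    rw [one_mul, lp.norm_eq_tsum_rpow h2, lp.norm_eq_tsum_rpow h2]
    exact le_of_eq (congrArg (fun s : ℝ => s ^ (1 / (2 : ℝ≥0∞).toReal))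
      ((Equiv.subRight n).tsum_eq (fun x : ℤ => ‖Ψ x‖ ^ (2 : ℝ≥0∞).toReal))))

theorem siteTranslate_apply (n : ℤ) (Ψ : WalkSpace) (x : ℤ) : siteTranslate n Ψ x = Ψ (x - n) := rfl

/-- The conditional shift `S = ∑ₓ |x + 1⟩⟨x| ⊗ |0⟩⟨0| + |x - 1⟩⟨x| ⊗ |1⟩⟨1|`. -/
def shift : WalkSpace →L[ℂ] WalkSpace :=
  siteTranslate 1 * onCoin !![1, 0; 0, 0] + siteTranslate (-1) * onCoin !![0, 0; 0, 1]

/-- One step of the walk, `U = S (𝟙 ⊗ C_{θ,α,β})`. -/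
def walkStep (θ α β : ℝ) : WalkSpace →L[ℂ] WalkSpace :=
  shift * onCoin (coinMatrix θ α β)

/-- The state `U^t Ψ₀` of the walker after `t` steps. -/
def walkState (θ α β : ℝ) (t : ℕ) (Ψ₀ : WalkSpace) : WalkSpace :=
  (walkStep θ α β ^ t) Ψ₀

/-- The pure state `|Ψ⟩⟨Ψ|`. -/
def pureState (Ψ : WalkSpace) : WalkSpace →L[ℂ] WalkSpace :=
  InnerProductSpace.rankOne ℂ Ψ Ψ

/-- The trace of an operator, computed in the orthonormal basis `|x⟩ ⊗ |j⟩`. -/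
def walkTrace (A : WalkSpace →L[ℂ] WalkSpace) : ℂ :=
  ∑' i : ℤ × Fin 2,
    inner ℂ (localizedState i.1 (EuclideanSpace.single i.2 1))
      (A (localizedState i.1 (EuclideanSpace.single i.2 1)))

/-- `L` is a symmetric logarithmic derivative of the statistical model `ρ` at `Θ` for the parameter
`μ`: it is self-adjoint, and the partial derivative `∂_μ ρ` exists at `Θ` (in operator norm) and
equals `(L ρ + ρ L) / 2`. -/
def IsSLD {ι : Type} [DecidableEq ι] (ρ : (ι → ℝ) → (WalkSpace →L[ℂ] WalkSpace)) (Θ : ι → ℝ)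
    (μ : ι) (L : WalkSpace →L[ℂ] WalkSpace) : Prop :=
  IsSelfAdjoint L ∧
    HasDerivAt (fun s : ℝ => ρ (Function.update Θ μ s))
      ((1 / 2 : ℂ) • (L * ρ Θ + ρ Θ * L)) (Θ μ)

/-- A symmetric logarithmic derivative (the Fisher information does not depend on the choice). -/
def sld {ι : Type} [DecidableEq ι] (ρ : (ι → ℝ) → (WalkSpace →L[ℂ] WalkSpace)) (Θ : ι → ℝ)
    (μ : ι) : WalkSpace →L[ℂ] WalkSpace :=
  Classical.epsilon (IsSLD ρ Θ μ)

/-- The quantum Fisher information matrix `F_{μν} = Tr(ρ {L_μ, L_ν}) / 2` of the model `ρ`. -/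
def qfiMatrix {ι : Type} [DecidableEq ι] (ρ : (ι → ℝ) → (WalkSpace →L[ℂ] WalkSpace))
    (Θ : ι → ℝ) : Matrix ι ι ℝ :=
  Matrix.of fun μ ν =>
    (1 / 2) * (walkTrace (ρ Θ * (sld ρ Θ μ * sld ρ Θ ν + sld ρ Θ ν * sld ρ Θ μ))).re

/-- The two-parameter model `(θ, φ) ↦ |Ψ(t)⟩⟨Ψ(t)|` with `φ = α - β` and `β` held fixed (so that
`∂_φ` is `∂_α`), for the initial state `Ψ₀`. -/
def walkModel (β : ℝ) (t : ℕ) (Ψ₀ : WalkSpace) (Θ : Fin 2 → ℝ) : WalkSpace →L[ℂ] WalkSpace :=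
  pureState (walkState (Θ 0) (Θ 1 + β) β t Ψ₀)

/-- The Pauli matrices `σ_x, σ_y, σ_z`. -/
def pauli : Fin 3 → Matrix (Fin 2) (Fin 2) ℂ :=
  ![!![0, 1; 1, 0], !![0, -Complex.I; Complex.I, 0], !![1, 0; 0, -1]]

/-- The Bloch vector `r_i = Tr(|χ⟩⟨χ| σ_i)` of the coin state `χ`. -/
def blochVector (χ : CoinSpace) : Fin 3 → ℝ := fun i =>
  (Matrix.trace (Matrix.vecMulVec χ.ofLp (star χ.ofLp) * pauli i)).re

/-- The unit vector `n = (sin θ cos φ, sin θ sin φ, cos θ)`. -/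
def nHat (θ φ : ℝ) : Fin 3 → ℝ :=
  ![Real.sin θ * Real.cos φ, Real.sin θ * Real.sin φ, Real.cos θ]

end

/-! Let Z be translation by one site times `e^{iα}`, that is `e^{-i(k-α)}` in momentum space. At
each momentum the step U lies in SU(2), so U = T + M, where T = (U + U*)/2 = cos θ cos(k-α) is
scalar on the coin and M = (U - U*)/2 satisfies M² = -(1 - T²). A parameter derivative has the form
∂U = UA with A acting on the coin only, and MA + AM = 2g is again scalar on the coin, with g = ∂T.

Suppose sin θ > 0. Then R = (1 - T²)⁻¹ is bounded, and A = P + Q with P = -gRM commuting with U and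
Q anticommuting with M. Hence U*Q = QU, which makes UQ a coboundary XU - UX
(`exists_coboundary_of_anticommutator`). Coboundaries telescope in ∂(U^t), so U^{-t} ∂(U^t) Ψ = tPΨ
+ O(1) (`hasGrowthRate_of_coboundary`). For pure states the Fisher information is four times the
real part of the covariance of the state derivatives (`qfiMatrix_pureState`), so F/t² tends to the
same expression in the vectors P_μ Ψ.

At a localized state these covariances are Fourier coefficients. P_μ* P_ν = g_μ g_ν R is scalar on
the coin, and R is a Poisson kernel in 2(k-α): its coefficient of order 0 is 1/sin θ and those of
order ±2 are q/sin θ, with q = (1 - sin θ)/(1 + sin θ) (`inner_driftOp_driftOp`, `inner_driftOp`).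

If sin θ = 0, then 1 - T² is not invertible, but the two coin components decouple. The φ generator
commutes with U. The θ generator exchanges left and right movers, and the derivative becomes a
bounded operator applied to a sum of t orthonormal vectors, which is only O(√t). -/

noncomputable section

/-! ### Coin operators, translations and the site basis -/

theorem onCoin_add (A B : Matrix (Fin 2) (Fin 2) ℂ) : onCoin (A + B) = onCoin A + onCoin B := by
  ext1 Ψ
  refine lp.ext (funext fun x => ?_)
  simp [onCoin_apply]

theorem onCoin_smul (a : ℂ) (A : Matrix (Fin 2) (Fin 2) ℂ) : onCoin (a • A) = a • onCoin A := by
  ext1 Ψ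
  refine lp.ext (funext fun x => ?_)
  simp [onCoin_apply]

theorem onCoin_neg (A : Matrix (Fin 2) (Fin 2) ℂ) : onCoin (-A) = -onCoin A := by
  rw [← neg_one_smul ℂ, onCoin_smul, neg_one_smul]

theorem onCoin_sub (A B : Matrix (Fin 2) (Fin 2) ℂ) : onCoin (A - B) = onCoin A - onCoin B := by
  rw [sub_eq_add_neg, onCoin_add, onCoin_neg, sub_eq_add_neg]

theorem onCoin_mul (A B : Matrix (Fin 2) (Fin 2) ℂ) : onCoin (A * B) = onCoin A * onCoin B := by
  ext1 Ψ
  refine lp.ext (funext fun x => ?_)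
  simp [onCoin_apply]

theorem onCoin_zero : onCoin 0 = 0 := by
  ext1 Ψ
  refine lp.ext (funext fun x => ?_)
  simp [onCoin_apply]

theorem onCoin_one : onCoin 1 = 1 := by
  ext1 Ψ
  refine lp.ext (funext fun x => ?_)
  simp [onCoin_apply]

theorem star_onCoin (A : Matrix (Fin 2) (Fin 2) ℂ) : star (onCoin A) = onCoin (star A) := by
  symm
  rw [ContinuousLinearMap.star_eq_adjoint, ContinuousLinearMap.eq_adjoint_iff]
  intro Φ Ψ
  rw [lp.inner_eq_tsum, lp.inner_eq_tsum]
  refine tsum_congr fun x => ?_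
  rw [onCoin_apply, onCoin_apply, map_star, ContinuousLinearMap.star_eq_adjoint,
    ContinuousLinearMap.adjoint_inner_left]

theorem siteTranslate_zero : siteTranslate 0 = 1 := by
  ext1 Ψ
  refine lp.ext (funext fun x => ?_)
  simp [siteTranslate_apply]

theorem siteTranslate_mul (m n : ℤ) : siteTranslate m * siteTranslate n = siteTranslate (m + n) := by
  ext1 Ψ
  refine lp.ext (funext fun x => ?_)
  simp [siteTranslate_apply, sub_sub]

theorem star_siteTranslate (n : ℤ) : star (siteTranslate n) = siteTranslate (-n) := by
  symm
  rw [ContinuousLinearMap.star_eq_adjoint, ContinuousLinearMap.eq_adjoint_iff]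
  intro Φ Ψ
  rw [lp.inner_eq_tsum, lp.inner_eq_tsum, ← (Equiv.subRight n).tsum_eq]
  refine tsum_congr fun x => ?_
  simp [siteTranslate_apply]

theorem commute_siteTranslate_onCoin (n : ℤ) (A : Matrix (Fin 2) (Fin 2) ℂ) :
    Commute (siteTranslate n) (onCoin A) := by
  ext1 Ψ
  refine lp.ext (funext fun x => ?_)
  simp [onCoin_apply, siteTranslate_apply]

theorem inner_localizedState_left (x : ℤ) (χ : CoinSpace) (Ψ : WalkSpace) :
    inner ℂ (localizedState x χ) Ψ = inner ℂ χ (Ψ x) :=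
  lp.inner_single_left x χ Ψ

theorem norm_localizedState (x : ℤ) (χ : CoinSpace) : ‖localizedState x χ‖ = ‖χ‖ :=
  lp.norm_single (E := fun _ : ℤ => CoinSpace) (p := 2) (by norm_num) x χ

theorem localizedState_apply_self (x : ℤ) (χ : CoinSpace) : localizedState x χ x = χ := by
  simp [localizedState]

theorem localizedState_apply_ne {x y : ℤ} (h : y ≠ x) (χ : CoinSpace) :
    localizedState x χ y = 0 := by
  simp [localizedState, h]

theorem onCoin_localizedState (A : Matrix (Fin 2) (Fin 2) ℂ) (x : ℤ) (χ : CoinSpace) :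
    onCoin A (localizedState x χ)
      = localizedState x (Matrix.toEuclideanCLM (n := Fin 2) (𝕜 := ℂ) A χ) := by
  refine lp.ext (funext fun y => ?_)
  rw [onCoin_apply]
  rcases eq_or_ne y x with rfl | h
  · simp [localizedState_apply_self]
  · simp [localizedState_apply_ne h]

/-- The orthonormal basis `|x⟩ ⊗ |j⟩` of the lattice-coin space. -/
def siteCoinBasis : HilbertBasis (ℤ × Fin 2) ℂ WalkSpace :=
  HilbertBasis.mkOfOrthogonalEqBot
    (v := fun i : ℤ × Fin 2 => localizedState i.1 (EuclideanSpace.single i.2 1))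
    (by
      classical
      rw [orthonormal_iff_ite]
      rintro ⟨x, j⟩ ⟨y, k⟩
      rw [inner_localizedState_left]
      rcases eq_or_ne x y with rfl | h
      · simp [localizedState_apply_self, EuclideanSpace.inner_single_left]
      · simp [localizedState_apply_ne h, h])
    (by
      rw [Submodule.eq_bot_iff]
      intro Ψ hΨ
      refine lp.ext (funext fun x => ?_)
      ext j
      have h := (Submodule.mem_orthogonal _ _).1 hΨ _
        (Submodule.subset_span ⟨(x, j), rfl⟩)
      rw [inner_localizedState_left] at h
      simpa [EuclideanSpace.inner_single_left] using h)

theorem siteCoinBasis_apply (i : ℤ × Fin 2) :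
    siteCoinBasis i = localizedState i.1 (EuclideanSpace.single i.2 1) := by
  simp [siteCoinBasis]

/-- Parseval in the basis `siteCoinBasis`, after moving K to the left slot as its adjoint. -/
theorem walkTrace_pureState_mul (Ψ : WalkSpace) (K : WalkSpace →L[ℂ] WalkSpace) :
    walkTrace (pureState Ψ * K) = inner ℂ Ψ (K Ψ) := by
  rw [← ContinuousLinearMap.adjoint_inner_left, ← siteCoinBasis.tsum_inner_mul_inner]
  refine tsum_congr fun i => ?_
  rw [← siteCoinBasis_apply]
  simp [pureState, ContinuousLinearMap.adjoint_inner_left]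

/-! ### Splitting a generator into a commuting part and a coboundary -/

section Decomposition

variable {𝓐 : Type*} [Ring 𝓐] [Algebra ℂ 𝓐]

/-- An element whose anticommutator with the "sine part" `M` of a unit `U = T + M` is central
splits into a part commuting with `U` and a coboundary. -/
theorem exists_coboundary_of_anticommutator {U V A T M R g : 𝓐} (hVU : V * U = 1) (hUV : U * V = 1)
    (hU : U = T + M) (hV : V = T - M) (hTA : Commute T A)
    (hRT : Commute R T) (hRM : Commute R M)
    (hgT : Commute g T) (hgM : Commute g M)
    (hR : R * (1 - T * T) = 1) (hg : M * A + A * M = (2 : ℂ) • g) :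
    ∃ X : 𝓐, Commute (-(g * R * M)) U ∧
      U * A = U * -(g * R * M) + X * U - U * X := by
  have hTM : T * M = M * T := by
    have h1 : (T + M) * (T - M) = (T - M) * (T + M) := by rw [← hU, ← hV, hVU, hUV]
    have h2 : (2 : ℂ) • (T * M - M * T) = 0 := by
      rw [two_smul]
      calc _ = (T - M) * (T + M) - (T + M) * (T - M) := by noncomm_ring
        _ = 0 := by rw [h1, sub_self]
    exact sub_eq_zero.1 ((smul_eq_zero_iff_right two_ne_zero).1 h2)
  have hMM : T * T - M * M = 1 := by
    calc T * T - M * M = (T + M) * (T - M) + (T * M - M * T) := by noncomm_ring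
      _ = 1 := by rw [hTM, sub_self, add_zero, ← hU, ← hV, hUV]
  have hRMM : R * M * M = -1 := by
    have : M * M = -(1 - T * T) := by rw [← hMM]; abel
    rw [mul_assoc, this, mul_neg, hR]
  have hMT : Commute M T := hTM.symm
  have hPT : Commute (g * R * M) T := (hgT.mul_left hRT).mul_left hMT
  have hPM : Commute (g * R * M) M := (hgM.mul_left hRM).mul_left (Commute.refl M)
  have hPU : Commute (g * R * M) U := by rw [hU]; exact hPT.add_right hPM
  -- Q is what remains of A after removing its component along M. As R M² = -1, it anticommutes with
  -- M, whence V Q = Q U.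
  obtain ⟨Q, hQ⟩ : ∃ Q, Q = A + g * R * M := ⟨_, rfl⟩
  have hTQ : T * Q = Q * T := by
    rw [hQ, mul_add, add_mul, hTA.eq, hPT.eq]
  have hgRMM : g * R * M * M = -g := by
    rw [mul_assoc g, mul_assoc g, hRMM, mul_neg, mul_one]
  have hMQ : M * Q = -(Q * M) := by
    rw [eq_neg_iff_add_eq_zero, hQ, mul_add, add_mul, ← hPM.eq, hgRMM]
    calc M * A + -g + (A * M + -g) = (M * A + A * M) - (2 : ℂ) • g := by rw [two_smul]; abel
      _ = 0 := by rw [hg, sub_self]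
  have hVQ : V * Q = Q * U := by
    rw [hV, hU, sub_mul, mul_add, hTQ, hMQ, sub_neg_eq_add]
  have hRU : R * U = U * R := by rw [hU]; exact (hRT.add_right hRM).eq
  have hMU : M * U = U * M := by rw [hU, mul_add, add_mul, hTM]
  -- Passing U through Q turns it into V, so conjugating Q R M V and subtracting leaves Q R M (U -
  -- V) = 2 Q R M² = -2 Q; the factor -1/2 normalizes this.
  refine ⟨-(1 / 2 : ℂ) • (Q * R * M * V), hPU.neg_left, ?_⟩
  have hA : A = -(g * R * M) + Q := by rw [hQ]; abel
  have hUVM : U - V = (2 : ℂ) • M := by rw [hU, hV, two_smul]; abel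
  have key : V * (Q * R * M * V) * U - Q * R * M * V = -((2 : ℂ) • Q) := by
    calc V * (Q * R * M * V) * U - Q * R * M * V
        = (V * Q) * R * M * (V * U) - Q * R * M * V := by noncomm_ring
      _ = Q * (U * R) * M - Q * R * M * V := by rw [hVQ, hVU]; noncomm_ring
      _ = Q * R * (U * M) - Q * R * M * V := by rw [← hRU]; noncomm_ring
      _ = Q * R * M * (U - V) := by rw [← hMU]; noncomm_ring
      _ = (2 : ℂ) • (Q * (R * M * M)) := by rw [hUVM, mul_smul_comm]; noncomm_ring
      _ = _ := by rw [hRMM]; simp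
  have key2 : (Q * R * M * V) * U - U * (Q * R * M * V) = -((2 : ℂ) • (U * Q)) := by
    calc (Q * R * M * V) * U - U * (Q * R * M * V)
        = (U * V) * (Q * R * M * V) * U - U * (Q * R * M * V) := by rw [hUV, one_mul]
      _ = U * (V * (Q * R * M * V) * U - Q * R * M * V) := by noncomm_ring
      _ = _ := by rw [key]; simp
  rw [add_sub_assoc, smul_mul_assoc, mul_smul_comm, ← smul_sub, key2, smul_neg, neg_smul, neg_neg,
    smul_smul, show (1 / 2 * 2 : ℂ) = 1 by norm_num, one_smul, ← mul_add, ← hA]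

end Decomposition

/-- The derivative of the powers of a differentiable curve in a Banach algebra. -/
theorem HasDerivAt.pow_of_coboundary {𝓐 : Type*} [NormedRing 𝓐] [NormedAlgebra ℝ 𝓐]
    {U : ℝ → 𝓐} {P X : 𝓐} {s : ℝ} (hP : Commute P (U s))
    (hU : HasDerivAt U (U s * P + X * U s - U s * X) s) (t : ℕ) :
    HasDerivAt (fun r => U r ^ t) (t • (U s ^ t * P) + X * U s ^ t - U s ^ t * X) s := by
  induction t with
  | zero => simpa using hasDerivAt_const s (1 : 𝓐)
  | succ t ih =>
    have h := hU.mul ih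
    have hPt : P * U s ^ t = U s ^ t * P := (hP.pow_right t).eq
    refine (h.congr_deriv ?_).congr_of_eventuallyEq
      (Filter.Eventually.of_forall fun r => pow_succ' (U r) t)
    -- The term -U X U^t from the new factor cancels U X U^t from the induction hypothesis.
    simp only [pow_succ', sub_mul, add_mul, mul_add, mul_sub, mul_assoc, hPt, succ_nsmul,
      mul_smul_comm]
    abel

/-! ### Symmetric logarithmic derivatives and Fisher information of pure states -/

theorem real_smul_walkSpace (a : ℝ) (Ψ : WalkSpace) : a • Ψ = (a : ℂ) • Ψ :=
  (Complex.coe_smul a Ψ).symm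

/-- `rankOne` is conjugate-linear in its second argument, hence bilinear over ℝ only; this suffices
for a real parameter. -/
theorem HasDerivAt.pureState {Ψ : ℝ → WalkSpace} {d : WalkSpace} {s : ℝ} (h : HasDerivAt Ψ d s) :
    HasDerivAt (fun r => pureState (Ψ r))
      (InnerProductSpace.rankOne ℂ (Ψ s) d + InnerProductSpace.rankOne ℂ d (Ψ s)) s := by
  have hb : IsBoundedBilinearMap ℝ
      (fun p : WalkSpace × WalkSpace => InnerProductSpace.rankOne ℂ p.1 p.2) :=
    { add_left := fun x y z => by simp
      smul_left := fun a x z => by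
        ext1 v
        simp only [InnerProductSpace.rankOne_apply, smul_apply, real_smul_walkSpace]
        rw [smul_comm]
      add_right := fun x y z => by simp
      smul_right := fun a x z => by
        ext1 v
        simp only [InnerProductSpace.rankOne_apply, smul_apply,
          real_smul_walkSpace, inner_smul_left, Complex.conj_ofReal, smul_smul]
      bound := ⟨1, one_pos, fun x z => by simp⟩ }
  exact (hb.hasFDerivAt (Ψ s, Ψ s)).comp_hasDerivAt s (h.prodMk h)

theorem re_inner_eq_zero_of_norm_eq_one {Ψ : ℝ → WalkSpace} {d : WalkSpace} {s : ℝ}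
    (h : HasDerivAt Ψ d s) (hn : ∀ r, ‖Ψ r‖ = 1) :
    inner ℂ d (Ψ s) + inner ℂ (Ψ s) d = 0 := by
  have h1 := h.inner ℂ h
  have h2 : (fun r => inner ℂ (Ψ r) (Ψ r)) = fun _ => (1 : ℂ) := by
    funext r
    rw [inner_self_eq_norm_sq_to_K, hn r]
    simp
  rw [h2] at h1
  rw [add_comm]
  exact h1.unique (hasDerivAt_const s (1 : ℂ))

section PureModel

variable {ι : Type} [DecidableEq ι] {Ψ : (ι → ℝ) → WalkSpace} {Θ : ι → ℝ}

/-- Differentiating ρ² = ρ gives ∂ρ = ρ ∂ρ + ∂ρ ρ, so L = 2 ∂ρ works. -/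
theorem exists_isSLD_pureState {μ : ι} {d : WalkSpace} (hn : ∀ Θ, ‖Ψ Θ‖ = 1)
    (h : HasDerivAt (fun s => Ψ (Function.update Θ μ s)) d (Θ μ)) :
    ∃ L, IsSLD (fun Θ => pureState (Ψ Θ)) Θ μ L := by
  have h0 : inner ℂ d (Ψ Θ) + inner ℂ (Ψ Θ) d = 0 := by
    simpa using re_inner_eq_zero_of_norm_eq_one h fun r => hn _
  refine ⟨(2 : ℂ) • (InnerProductSpace.rankOne ℂ (Ψ Θ) d + InnerProductSpace.rankOne ℂ d (Ψ Θ)),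
    ?_, ?_⟩
  · rw [IsSelfAdjoint, star_smul, star_add, ContinuousLinearMap.star_eq_adjoint,
      ContinuousLinearMap.star_eq_adjoint, InnerProductSpace.adjoint_rankOne,
      InnerProductSpace.adjoint_rankOne, add_comm]
    simp
  · refine h.pureState.congr_deriv ?_
    ext1 v
    have h1 : inner ℂ (Ψ Θ) (Ψ Θ) = (1 : ℂ) := by
      rw [inner_self_eq_norm_sq_to_K, hn]; simp
    have h2 : inner ℂ d (Ψ Θ) = - inner ℂ (Ψ Θ) d := eq_neg_of_add_eq_zero_left h0
    simp only [Function.update_eq_self, pureState, add_apply,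
      smul_apply, mul_apply_eq_comp,
      InnerProductSpace.rankOne_apply, inner_add_right, inner_smul_right, h1, h2]
    module

/-- A symmetric logarithmic derivative is not unique, but its value at Ψ is, and the Fisher
information depends on nothing else. -/
theorem IsSLD.apply_eq {μ : ι} {d : WalkSpace} (hn : ∀ Θ, ‖Ψ Θ‖ = 1)
    (h : HasDerivAt (fun s => Ψ (Function.update Θ μ s)) d (Θ μ))
    {L : WalkSpace →L[ℂ] WalkSpace} (hL : IsSLD (fun Θ => pureState (Ψ Θ)) Θ μ L) :
    L (Ψ Θ) = (2 : ℂ) • (d - inner ℂ (Ψ Θ) d • Ψ Θ) := by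
  have h0 : inner ℂ d (Ψ Θ) + inner ℂ (Ψ Θ) d = 0 := by
    simpa using re_inner_eq_zero_of_norm_eq_one h fun r => hn _
  have h1 : inner ℂ (Ψ Θ) (Ψ Θ) = (1 : ℂ) := by
    rw [inner_self_eq_norm_sq_to_K, hn]; simp
  have h2 : inner ℂ d (Ψ Θ) = - inner ℂ (Ψ Θ) d := eq_neg_of_add_eq_zero_left h0
  have h3 := congrArg (fun A : WalkSpace →L[ℂ] WalkSpace => A (Ψ Θ))
    (hL.2.unique h.pureState)
  simp only [Function.update_eq_self, pureState, add_apply,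
    smul_apply, mul_apply_eq_comp,
    InnerProductSpace.rankOne_apply, h1, h2, one_smul] at h3
  -- Pairing with Ψ kills the right-hand side, so L has zero expectation in Ψ.
  have h4 : inner ℂ (Ψ Θ) (L (Ψ Θ)) = 0 := by
    have := congrArg (inner ℂ (Ψ Θ)) h3
    simp only [inner_add_right, inner_smul_right, h1] at this
    linear_combination this
  rw [h4, zero_smul, add_zero] at h3
  calc L (Ψ Θ) = (2 : ℂ) • (1 / 2 : ℂ) • L (Ψ Θ) := by rw [smul_smul]; norm_num
    _ = _ := by rw [h3]; module

/-- The quantum Fisher information matrix of a model of pure states. -/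
theorem qfiMatrix_pureState {d : ι → WalkSpace} (hn : ∀ Θ, ‖Ψ Θ‖ = 1)
    (h : ∀ μ, HasDerivAt (fun s => Ψ (Function.update Θ μ s)) (d μ) (Θ μ)) (μ ν : ι) :
    qfiMatrix (fun Θ => pureState (Ψ Θ)) Θ μ ν
      = 4 * (inner ℂ (d μ) (d ν) - inner ℂ (d μ) (Ψ Θ) * inner ℂ (Ψ Θ) (d ν)).re := by
  have hs : ∀ μ, IsSLD (fun Θ => pureState (Ψ Θ)) Θ μ (sld (fun Θ => pureState (Ψ Θ)) Θ μ) :=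
    fun μ => Classical.epsilon_spec (exists_isSLD_pureState hn (h μ))
  have h1 : inner ℂ (Ψ Θ) (Ψ Θ) = (1 : ℂ) := by
    rw [inner_self_eq_norm_sq_to_K, hn]; simp
  have key : ∀ μ ν, inner ℂ (Ψ Θ) (sld (fun Θ => pureState (Ψ Θ)) Θ μ
      (sld (fun Θ => pureState (Ψ Θ)) Θ ν (Ψ Θ)))
      = 4 * (inner ℂ (d μ) (d ν) - inner ℂ (d μ) (Ψ Θ) * inner ℂ (Ψ Θ) (d ν)) := by
    intro μ ν
    have hsa := (hs μ).1
    rw [ContinuousLinearMap.isSelfAdjoint_iff'] at hsa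
    rw [← ContinuousLinearMap.adjoint_inner_left, hsa, (hs μ).apply_eq hn (h μ),
      (hs ν).apply_eq hn (h ν)]
    simp only [inner_smul_left, inner_smul_right, inner_sub_left, inner_sub_right, h1,
      inner_conj_symm, map_ofNat]
    ring
  -- The two orderings in the anticommutator are complex conjugates, so their real parts agree.
  have hsymm : (inner ℂ (d ν) (d μ) - inner ℂ (d ν) (Ψ Θ) * inner ℂ (Ψ Θ) (d μ)).re
      = (inner ℂ (d μ) (d ν) - inner ℂ (d μ) (Ψ Θ) * inner ℂ (Ψ Θ) (d ν)).re := by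
    rw [← Complex.conj_re]
    simp only [map_sub, map_mul, inner_conj_symm]
    rw [mul_comm]
  rw [qfiMatrix, Matrix.of_apply, walkTrace_pureState_mul]
  simp only [add_apply, mul_apply_eq_comp, inner_add_right, key,
    Complex.add_re]
  rw [show (4 : ℂ) = ((4 : ℝ) : ℂ) by norm_num, Complex.re_ofReal_mul, Complex.re_ofReal_mul, hsymm]
  ring

end PureModel

/-- If the derivatives of the state grow linearly, the Fisher information grows quadratically, with
the covariance of the growth rates as its leading coefficient. -/
theorem tendsto_re_covariance {U : WalkSpace →L[ℂ] WalkSpace} (hU : star U * U = 1)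
    {Ψ₀ v w : WalkSpace} {e f : ℕ → WalkSpace}
    (he : Filter.Tendsto (fun t : ℕ => (t : ℝ)⁻¹ • e t) Filter.atTop (nhds v))
    (hf : Filter.Tendsto (fun t : ℕ => (t : ℝ)⁻¹ • f t) Filter.atTop (nhds w)) :
    Filter.Tendsto (fun t : ℕ => 4 * (inner ℂ ((U ^ t) (e t)) ((U ^ t) (f t))
      - inner ℂ ((U ^ t) (e t)) ((U ^ t) Ψ₀) * inner ℂ ((U ^ t) Ψ₀) ((U ^ t) (f t))).re / (t : ℝ) ^ 2)
      Filter.atTop (nhds (4 * (inner ℂ v w - inner ℂ v Ψ₀ * inner ℂ Ψ₀ w).re)) := by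
  have hi : ∀ (t : ℕ) (x y : WalkSpace), inner ℂ ((U ^ t) x) ((U ^ t) y) = inner ℂ x y := by
    intro t x y
    have h : star (U ^ t) * U ^ t = 1 := by
      induction t with
      | zero => simp
      | succ t ih =>
        rw [pow_succ' U, star_mul, mul_assoc, ← mul_assoc (star U), hU, one_mul, ih]
    rw [← ContinuousLinearMap.adjoint_inner_right, ← ContinuousLinearMap.star_eq_adjoint,
      ← mul_apply_eq_comp, h, one_apply_eq_self]
  have hlim := ((he.inner hf (𝕜 := ℂ)).sub ((he.inner (𝕜 := ℂ) (tendsto_const_nhds (x := Ψ₀))).mul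
    ((tendsto_const_nhds (x := Ψ₀)).inner hf (𝕜 := ℂ))))
  refine (((Complex.continuous_re.tendsto _).comp hlim).const_mul 4).congr fun t => ?_
  simp only [hi, Function.comp_apply]
  simp only [real_smul_walkSpace, inner_smul_left, inner_smul_right, Complex.conj_ofReal]
  rw [show ∀ a b c : ℂ, ((t : ℝ)⁻¹ : ℝ) * (((t : ℝ)⁻¹ : ℝ) * a)
      - ((t : ℝ)⁻¹ : ℝ) * b * (((t : ℝ)⁻¹ : ℝ) * c)
      = (((t : ℝ)⁻¹ * (t : ℝ)⁻¹ : ℝ) : ℂ) * (a - b * c) by intro a b c; push_cast; ring,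
    Complex.re_ofReal_mul]
  ring

/-! ### The step as a Laurent polynomial in a phased translation; unitarity -/

/-- The coin-independent shift with the phase `e^{iα}`, i.e. multiplication by `e^{-i(k-α)}` in
momentum space. -/
def phaseShift (α : ℝ) : WalkSpace →L[ℂ] WalkSpace :=
  Complex.exp (Complex.I * α) • siteTranslate 1

theorem star_phaseShift (α : ℝ) :
    star (phaseShift α) = Complex.exp (-(Complex.I * α)) • siteTranslate (-1) := by
  rw [phaseShift, star_smul, star_siteTranslate]
  simp [← Complex.exp_conj]

theorem star_phaseShift_mul_self (α : ℝ) : star (phaseShift α) * phaseShift α = 1 := by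
  rw [star_phaseShift, phaseShift, smul_mul_smul_comm, siteTranslate_mul, ← Complex.exp_add]
  simp [siteTranslate_zero]

theorem phaseShift_mul_star_self (α : ℝ) : phaseShift α * star (phaseShift α) = 1 := by
  rw [star_phaseShift, phaseShift, smul_mul_smul_comm, siteTranslate_mul, ← Complex.exp_add]
  simp [siteTranslate_zero]

theorem commute_phaseShift_onCoin (α : ℝ) (A : Matrix (Fin 2) (Fin 2) ℂ) :
    Commute (phaseShift α) (onCoin A) :=
  (commute_siteTranslate_onCoin 1 A).smul_left _

theorem commute_star_phaseShift_onCoin (α : ℝ) (A : Matrix (Fin 2) (Fin 2) ℂ) :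
    Commute (star (phaseShift α)) (onCoin A) := by
  rw [star_phaseShift]
  exact (commute_siteTranslate_onCoin (-1) A).smul_left _

/-- The right-moving part of the step in the gauge of `phaseShift`. -/
def rightCoin (θ φ : ℝ) : Matrix (Fin 2) (Fin 2) ℂ :=
  !![(Real.cos θ : ℂ), Complex.exp (-(Complex.I * φ)) * Real.sin θ; 0, 0]

/-- The left-moving part of the step in the gauge of `phaseShift`. -/
def leftCoin (θ φ : ℝ) : Matrix (Fin 2) (Fin 2) ℂ :=
  !![0, 0; -(Complex.exp (Complex.I * φ) * Real.sin θ), (Real.cos θ : ℂ)]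

/-- With β = α - φ the phase `e^{±iα}` factors out of each row of the coin and is absorbed into the
translation; the remaining matrices depend on θ and φ alone. -/
theorem walkStep_eq_phaseShift (θ φ β : ℝ) :
    walkStep θ (φ + β) β = phaseShift (φ + β) * onCoin (rightCoin θ φ)
      + star (phaseShift (φ + β)) * onCoin (leftCoin θ φ) := by
  have h0 : !![1, 0; 0, 0] * coinMatrix θ (φ + β) β
      = Complex.exp (Complex.I * (φ + β : ℝ)) • rightCoin θ φ := by
    rw [coinMatrix, rightCoin]
    ext i j
    fin_cases i <;> fin_cases j <;> simp [← mul_assoc, ← Complex.exp_add]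
    left; ring_nf
  have h1 : !![0, 0; 0, 1] * coinMatrix θ (φ + β) β
      = Complex.exp (-(Complex.I * (φ + β : ℝ))) • leftCoin θ φ := by
    rw [coinMatrix, leftCoin]
    ext i j
    fin_cases i <;> fin_cases j <;> simp [← mul_assoc, ← Complex.exp_add]
    left; ring_nf
  rw [walkStep, shift, add_mul, mul_assoc, mul_assoc, ← onCoin_mul, ← onCoin_mul, h0, h1,
    onCoin_smul, onCoin_smul, star_phaseShift, phaseShift, mul_smul_comm, mul_smul_comm,
    smul_mul_assoc, smul_mul_assoc]

theorem star_coinMatrix_mul_self (θ α β : ℝ) :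
    star (coinMatrix θ α β) * coinMatrix θ α β = 1 := by
  have h : (Complex.sin θ) ^ 2 + (Complex.cos θ) ^ 2 = 1 := Complex.sin_sq_add_cos_sq _
  have hcos : (starRingEnd ℂ) (Complex.cos θ) = Complex.cos θ := by
    rw [← Complex.ofReal_cos, Complex.conj_ofReal]
  have hsin : (starRingEnd ℂ) (Complex.sin θ) = Complex.sin θ := by
    rw [← Complex.ofReal_sin, Complex.conj_ofReal]
  rw [coinMatrix]
  ext i j
  fin_cases i <;> fin_cases j <;>
    simp [hcos, hsin, Matrix.mul_apply, Fin.sum_univ_two, Matrix.star_apply,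
      ← Complex.exp_conj, Complex.exp_neg] <;>
    field_simp <;> first | linear_combination h | ring

theorem star_shift_mul_self : star shift * shift = 1 := by
  have h0 : star (!![1, 0; 0, 0] : Matrix (Fin 2) (Fin 2) ℂ) = !![1, 0; 0, 0] := by
    ext i j; fin_cases i <;> fin_cases j <;> simp [Matrix.star_apply]
  have h1 : star (!![0, 0; 0, 1] : Matrix (Fin 2) (Fin 2) ℂ) = !![0, 0; 0, 1] := by
    ext i j; fin_cases i <;> fin_cases j <;> simp [Matrix.star_apply]
  have hc : ∀ (m n : ℤ) (A B : Matrix (Fin 2) (Fin 2) ℂ), onCoin A * siteTranslate m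
      * (siteTranslate n * onCoin B) = siteTranslate (m + n) * onCoin (A * B) := by
    intro m n A B
    rw [← (commute_siteTranslate_onCoin m A).eq, mul_assoc, ← mul_assoc (onCoin A),
      ← (commute_siteTranslate_onCoin n A).eq, mul_assoc, ← onCoin_mul, ← mul_assoc,
      siteTranslate_mul]
  rw [shift, star_add, star_mul, star_mul, star_onCoin, star_onCoin, star_siteTranslate,
    star_siteTranslate, h0, h1]
  have e00 : (!![1, 0; 0, 0] : Matrix (Fin 2) (Fin 2) ℂ) * !![1, 0; 0, 0] = !![1, 0; 0, 0] := by
    ext i j; fin_cases i <;> fin_cases j <;> simp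
  have e01 : (!![1, 0; 0, 0] : Matrix (Fin 2) (Fin 2) ℂ) * !![0, 0; 0, 1] = 0 := by
    ext i j; fin_cases i <;> fin_cases j <;> simp
  have e10 : (!![0, 0; 0, 1] : Matrix (Fin 2) (Fin 2) ℂ) * !![1, 0; 0, 0] = 0 := by
    ext i j; fin_cases i <;> fin_cases j <;> simp
  have e11 : (!![0, 0; 0, 1] : Matrix (Fin 2) (Fin 2) ℂ) * !![0, 0; 0, 1] = !![0, 0; 0, 1] := by
    ext i j; fin_cases i <;> fin_cases j <;> simp
  have hone : (!![1, 0; 0, 0] : Matrix (Fin 2) (Fin 2) ℂ) + !![0, 0; 0, 1] = 1 := by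
    ext i j; fin_cases i <;> fin_cases j <;> simp
  simp only [add_mul, mul_add, hc, e00, e01, e10, e11, onCoin_zero, mul_zero, add_zero, zero_add,
    neg_add_cancel, siteTranslate_zero, one_mul, ← onCoin_add, hone, onCoin_one]

theorem shift_mul_star_self : shift * star shift = 1 := by
  have h0 : star (!![1, 0; 0, 0] : Matrix (Fin 2) (Fin 2) ℂ) = !![1, 0; 0, 0] := by
    ext i j; fin_cases i <;> fin_cases j <;> simp [Matrix.star_apply]
  have h1 : star (!![0, 0; 0, 1] : Matrix (Fin 2) (Fin 2) ℂ) = !![0, 0; 0, 1] := by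
    ext i j; fin_cases i <;> fin_cases j <;> simp [Matrix.star_apply]
  have hc : ∀ (m n : ℤ) (A B : Matrix (Fin 2) (Fin 2) ℂ), siteTranslate m * onCoin A
      * (onCoin B * siteTranslate n) = siteTranslate (m + n) * onCoin (A * B) := by
    intro m n A B
    rw [← (commute_siteTranslate_onCoin n B).eq, mul_assoc, ← mul_assoc (onCoin A),
      ← (commute_siteTranslate_onCoin n A).eq, mul_assoc, ← onCoin_mul, ← mul_assoc,
      siteTranslate_mul]
  rw [shift, star_add, star_mul, star_mul, star_onCoin, star_onCoin, star_siteTranslate,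
    star_siteTranslate, h0, h1]
  have e00 : (!![1, 0; 0, 0] : Matrix (Fin 2) (Fin 2) ℂ) * !![1, 0; 0, 0] = !![1, 0; 0, 0] := by
    ext i j; fin_cases i <;> fin_cases j <;> simp
  have e01 : (!![1, 0; 0, 0] : Matrix (Fin 2) (Fin 2) ℂ) * !![0, 0; 0, 1] = 0 := by
    ext i j; fin_cases i <;> fin_cases j <;> simp
  have e10 : (!![0, 0; 0, 1] : Matrix (Fin 2) (Fin 2) ℂ) * !![1, 0; 0, 0] = 0 := by
    ext i j; fin_cases i <;> fin_cases j <;> simp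
  have e11 : (!![0, 0; 0, 1] : Matrix (Fin 2) (Fin 2) ℂ) * !![0, 0; 0, 1] = !![0, 0; 0, 1] := by
    ext i j; fin_cases i <;> fin_cases j <;> simp
  have hone : (!![1, 0; 0, 0] : Matrix (Fin 2) (Fin 2) ℂ) + !![0, 0; 0, 1] = 1 := by
    ext i j; fin_cases i <;> fin_cases j <;> simp
  simp only [add_mul, mul_add, hc, e00, e01, e10, e11, onCoin_zero, mul_zero, add_zero, zero_add,
    add_neg_cancel, siteTranslate_zero, one_mul, ← onCoin_add, hone, onCoin_one]

theorem star_walkStep_mul_self (θ α β : ℝ) : star (walkStep θ α β) * walkStep θ α β = 1 := by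
  rw [walkStep, star_mul, mul_assoc, ← mul_assoc (star shift), star_shift_mul_self, one_mul,
    star_onCoin, ← onCoin_mul, star_coinMatrix_mul_self, onCoin_one]

theorem walkStep_mul_star_self (θ α β : ℝ) : walkStep θ α β * star (walkStep θ α β) = 1 := by
  rw [walkStep, star_mul, mul_assoc, ← mul_assoc (onCoin _), star_onCoin, ← onCoin_mul,
    mul_eq_one_comm.1 (star_coinMatrix_mul_self θ α β), onCoin_one, one_mul, shift_mul_star_self]

theorem norm_walkState (θ α β : ℝ) (t : ℕ) (Ψ : WalkSpace) : ‖walkState θ α β t Ψ‖ = ‖Ψ‖ := by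
  induction t with
  | zero => simp [walkState]
  | succ t ih =>
    rw [← ih]
    have h : walkState θ α β (t + 1) Ψ = walkStep θ α β (walkState θ α β t Ψ) := by
      rw [walkState, pow_succ']; rfl
    rw [h]
    exact ContinuousLinearMap.norm_map_iff_adjoint_comp_self _ |>.2
      (star_walkStep_mul_self θ α β) _

/-! ### Parameter derivatives of the step -/

theorem hasDerivAt_onCoin {C : ℝ → Matrix (Fin 2) (Fin 2) ℂ} {C' : Matrix (Fin 2) (Fin 2) ℂ}
    {s : ℝ} (h : ∀ i j, HasDerivAt (fun r => C r i j) (C' i j) s) :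
    HasDerivAt (fun r => onCoin (C r)) (onCoin C') s := by
  -- Linearity in the four entries reduces operator-norm differentiability to that of scalar
  -- functions times fixed operators.
  have hsum : ∀ A : Matrix (Fin 2) (Fin 2) ℂ, onCoin A = A 0 0 • onCoin !![1, 0; 0, 0]
      + A 0 1 • onCoin !![0, 1; 0, 0] + (A 1 0 • onCoin !![0, 0; 1, 0]
      + A 1 1 • onCoin !![0, 0; 0, 1]) := by
    intro A
    rw [← onCoin_smul, ← onCoin_smul, ← onCoin_smul, ← onCoin_smul, ← onCoin_add, ← onCoin_add,
      ← onCoin_add]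
    congr 1
    ext i j
    fin_cases i <;> fin_cases j <;> simp
  rw [hsum C']
  simp_rw [hsum (C _)]
  have hk : ∀ (i j : Fin 2) (K : WalkSpace →L[ℂ] WalkSpace),
      HasDerivAt (fun r => C r i j • K) (C' i j • K) s :=
    fun i j K => HasDerivAt.smul_const (F := WalkSpace →L[ℂ] WalkSpace) (h i j) K
  exact ((hk 0 0 _).add (hk 0 1 _)).add ((hk 1 0 _).add (hk 1 1 _))

/-- The logarithmic derivative `C⁻¹ ∂_θ C` of the coin. -/
def thetaGenerator (φ : ℝ) : Matrix (Fin 2) (Fin 2) ℂ :=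
  !![0, Complex.exp (-(Complex.I * φ)); -Complex.exp (Complex.I * φ), 0]

/-- The logarithmic derivative `C⁻¹ ∂_α C` of the coin. -/
def phiGenerator (θ φ : ℝ) : Matrix (Fin 2) (Fin 2) ℂ :=
  (Complex.I * Real.cos θ) • !![(Real.cos θ : ℂ), Complex.exp (-(Complex.I * φ)) * Real.sin θ;
    Complex.exp (Complex.I * φ) * Real.sin θ, -(Real.cos θ : ℂ)]

theorem hasDerivAt_cexp_I_mul (a : ℝ) : HasDerivAt (fun r : ℝ => Complex.exp (Complex.I * r))
    (Complex.I * Complex.exp (Complex.I * a)) a := by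
  have h := ((Complex.ofRealCLM.hasDerivAt (x := a)).const_mul Complex.I).cexp
  simpa [mul_comm] using h

theorem hasDerivAt_cexp_neg_I_mul (a : ℝ) :
    HasDerivAt (fun r : ℝ => Complex.exp (-(Complex.I * r)))
      (-(Complex.I * Complex.exp (-(Complex.I * a)))) a := by
  have h := ((Complex.ofRealCLM.hasDerivAt (x := a)).const_mul Complex.I).neg.cexp
  simpa [mul_comm] using h

theorem hasDerivAt_walkStep_theta (θ φ β : ℝ) :
    HasDerivAt (fun s => walkStep s (φ + β) β)
      (walkStep θ (φ + β) β * onCoin (thetaGenerator φ)) θ := by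
  rw [walkStep, mul_assoc, ← onCoin_mul]
  have hc := (Real.hasDerivAt_cos θ).ofReal_comp
  have hs := (Real.hasDerivAt_sin θ).ofReal_comp
  refine (hasDerivAt_onCoin fun i j => ?_).const_mul shift
  fin_cases i <;> fin_cases j
  · refine (hc.const_mul _).congr_deriv ?_
    simp [coinMatrix, thetaGenerator, mul_add, Complex.exp_add]
    ring
  · refine (hs.const_mul _).congr_deriv ?_
    simp [coinMatrix, thetaGenerator, mul_add, Complex.exp_add, Complex.exp_neg]
    field_simp
  · refine (hs.const_mul _).neg.congr_deriv ?_
    simp [coinMatrix, thetaGenerator, mul_add, Complex.exp_add, Complex.exp_neg]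
    field_simp
  · refine (hc.const_mul _).congr_deriv ?_
    simp [coinMatrix, thetaGenerator, mul_add, Complex.exp_add, Complex.exp_neg]
    field_simp

theorem hasDerivAt_walkStep_phi (θ φ β : ℝ) :
    HasDerivAt (fun s => walkStep θ (s + β) β)
      (walkStep θ (φ + β) β * onCoin (phiGenerator θ φ)) φ := by
  rw [walkStep, mul_assoc, ← onCoin_mul]
  have hp := (hasDerivAt_cexp_I_mul (φ + β)).comp_add_const φ β
  have hm := (hasDerivAt_cexp_neg_I_mul (φ + β)).comp_add_const φ β
  have h : (Complex.sin θ) ^ 2 + (Complex.cos θ) ^ 2 = 1 := Complex.sin_sq_add_cos_sq _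
  refine (hasDerivAt_onCoin fun i j => ?_).const_mul shift
  fin_cases i <;> fin_cases j
  · refine (hp.mul_const _).congr_deriv ?_
    simp [coinMatrix, phiGenerator, mul_add, Complex.exp_add, Complex.exp_neg]
    linear_combination (-Complex.I * Complex.exp (Complex.I * φ) * Complex.exp (Complex.I * β)
      * Complex.cos θ) * h
  · refine (hasDerivAt_const _ _).congr_deriv ?_
    simp [coinMatrix, phiGenerator, mul_add, Complex.exp_add, Complex.exp_neg]
    field_simp
    ring
  · refine (hasDerivAt_const _ _).congr_deriv ?_
    simp [coinMatrix, phiGenerator, mul_add, Complex.exp_add, Complex.exp_neg]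
    field_simp
    ring
  · refine (hm.mul_const _).congr_deriv ?_
    simp [coinMatrix, phiGenerator, mul_add, Complex.exp_add, Complex.exp_neg]
    field_simp
    linear_combination Complex.cos θ * h

/-! ### The Poisson kernel and its Fourier coefficients -/

theorem Commute.of_inverse {𝓐 : Type*} [Monoid 𝓐] {a w k : 𝓐} (h₁ : a * w = 1) (h₂ : w * a = 1)
    (h : Commute a k) : Commute w k := by
  calc w * k = w * (k * a) * w := by rw [mul_assoc, mul_assoc, h₁, mul_one]
    _ = k * w := by rw [← h.eq, ← mul_assoc, h₂, one_mul]

theorem norm_phaseShift_le (α : ℝ) : ‖phaseShift α‖ ≤ 1 := by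
  refine ContinuousLinearMap.opNorm_le_bound _ zero_le_one fun Ψ => ?_
  rw [one_mul]
  exact (ContinuousLinearMap.norm_map_iff_adjoint_comp_self _ |>.2
    (star_phaseShift_mul_self α) Ψ).le

theorem HasSum.inner_apply {H : Type*} [NormedAddCommGroup H] [InnerProductSpace ℂ H]
    {K : ℕ → H →L[ℂ] H} {S : H →L[ℂ] H} (h : HasSum K S) (φ ψ : H) :
    HasSum (fun n => inner ℂ φ (K n ψ)) (inner ℂ φ (S ψ)) :=
  ((innerSL ℂ φ).comp (ContinuousLinearMap.apply ℂ H ψ)).hasSum h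

/-- The nome `(1 - sin θ) / (1 + sin θ)` of the Poisson kernel `1 / (1 - cos² θ cos² k)`. -/
def poissonRatio (θ : ℝ) : ℝ := (1 - Real.sin θ) / (1 + Real.sin θ)

/-- The analytic half of the Poisson kernel. -/
def poissonHalf (θ α : ℝ) : WalkSpace →L[ℂ] WalkSpace :=
  ∑' n : ℕ, ((poissonRatio θ : ℂ) • phaseShift α ^ 2) ^ n

/-- The operator `1 / (1 - cos² θ cos² (k - α))` in momentum space. -/
def poissonOp (θ α : ℝ) : WalkSpace →L[ℂ] WalkSpace :=
  (Real.sin θ : ℂ)⁻¹ • (poissonHalf θ α + star (poissonHalf θ α) - 1)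

section Poisson

variable {θ : ℝ} (α : ℝ)

theorem norm_poissonRatio_smul_lt_one (hs : 0 < Real.sin θ) :
    ‖(poissonRatio θ : ℂ) • phaseShift α ^ 2‖ < 1 := by
  have hq : |poissonRatio θ| < 1 := by
    rw [poissonRatio, abs_lt, lt_div_iff₀ (by linarith), div_lt_one (by linarith)]
    constructor <;> linarith
  calc ‖(poissonRatio θ : ℂ) • phaseShift α ^ 2‖ ≤ |poissonRatio θ| * 1 := by
        rw [norm_smul, Complex.norm_real, Real.norm_eq_abs, sq]
        refine mul_le_mul_of_nonneg_left ?_ (abs_nonneg _)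
        exact (norm_mul_le _ _).trans
          (mul_le_one₀ (norm_phaseShift_le α) (norm_nonneg _) (norm_phaseShift_le α))
    _ < 1 := by rwa [mul_one]

theorem poissonHalf_mul (hs : 0 < Real.sin θ) :
    poissonHalf θ α * (1 - (poissonRatio θ : ℂ) • phaseShift α ^ 2) = 1 :=
  geom_series_mul_neg _ (norm_poissonRatio_smul_lt_one α hs)

theorem mul_poissonHalf (hs : 0 < Real.sin θ) :
    (1 - (poissonRatio θ : ℂ) • phaseShift α ^ 2) * poissonHalf θ α = 1 :=
  mul_neg_geom_series _ (norm_poissonRatio_smul_lt_one α hs)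

theorem commute_poissonHalf (hs : 0 < Real.sin θ) {K : WalkSpace →L[ℂ] WalkSpace}
    (h : Commute (phaseShift α) K) : Commute (poissonHalf θ α) K :=
  Commute.of_inverse (mul_poissonHalf α hs) (poissonHalf_mul α hs)
    ((Commute.one_left K).sub_left ((h.pow_left 2).smul_left _))

theorem commute_star_poissonHalf (hs : 0 < Real.sin θ) {K : WalkSpace →L[ℂ] WalkSpace}
    (h : Commute (star (phaseShift α)) K) : Commute (star (poissonHalf θ α)) K := by
  have h' : Commute (phaseShift α) (star K) := by
    have := congrArg star h.eq
    rw [star_mul, star_mul, star_star] at this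
    exact this.symm
  have := congrArg star (commute_poissonHalf α hs h').eq
  rw [star_mul, star_mul, star_star] at this
  exact this.symm

theorem commute_poissonOp (hs : 0 < Real.sin θ) {K : WalkSpace →L[ℂ] WalkSpace}
    (h : Commute (phaseShift α) K) (h' : Commute (star (phaseShift α)) K) :
    Commute (poissonOp θ α) K :=
  (((commute_poissonHalf α hs h).add_left (commute_star_poissonHalf α hs h')).sub_left
    (Commute.one_left K)).smul_left _

theorem star_poissonOp : star (poissonOp θ α) = poissonOp θ α := by
  rw [poissonOp, star_smul, star_sub, star_add, star_star, star_one, add_comm (star _),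
    star_inv₀, Complex.star_def, Complex.conj_ofReal]

/-- With s = sin θ, 1 - T² = ((1 + s)²/4)(1 - q Z²)(1 - q Z*²). The geometric series W and W* invert
the two factors, so W + W* - 1 times their product is (1 - q Z*²) + (1 - q Z²) minus the product,
which is 1 - q². Finally (1 + s)²(1 - q²)/4 = s. -/
theorem poissonOp_mul (hs : 0 < Real.sin θ) :
    poissonOp θ α * (1 - ((Real.cos θ / 2 : ℂ) • (phaseShift α + star (phaseShift α)))
      * ((Real.cos θ / 2 : ℂ) • (phaseShift α + star (phaseShift α)))) = 1 := by
  set Z := phaseShift α with hZ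
  set W := poissonHalf θ α with hW
  set q : ℂ := (poissonRatio θ : ℂ) with hq
  have h1 : W * (1 - q • Z ^ 2) = 1 := poissonHalf_mul α hs
  have h2 : star W * (1 - q • star Z ^ 2) = 1 := by
    have := congrArg star (mul_poissonHalf α hs)
    rwa [star_mul, star_sub, star_smul, star_pow, star_one, Complex.star_def,
      Complex.conj_ofReal] at this
  have hZZ : Z * star Z = 1 := phaseShift_mul_star_self α
  have hZZ' : star Z * Z = 1 := star_phaseShift_mul_self α
  have hAB : Z ^ 2 * star Z ^ 2 = 1 := by
    rw [sq, sq, mul_assoc, ← mul_assoc Z (star Z), hZZ, one_mul, hZZ]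
  have hBA : star Z ^ 2 * Z ^ 2 = 1 := by
    rw [sq, sq, mul_assoc, ← mul_assoc (star Z) Z, hZZ', one_mul, hZZ']
  have hs' : (Real.sin θ : ℂ) ≠ 0 := by exact_mod_cast hs.ne'
  have hs1 : (1 + Real.sin θ : ℂ) ≠ 0 := by
    have : (1 + Real.sin θ : ℝ) ≠ 0 := by linarith
    exact_mod_cast this
  have hq' : q = (1 - Real.sin θ) / (1 + Real.sin θ) := by rw [hq, poissonRatio]; push_cast; rfl
  have hc : (Real.cos θ : ℂ) ^ 2 = 1 - (Real.sin θ : ℂ) ^ 2 := by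
    have := Real.sin_sq_add_cos_sq θ
    have h : ((Real.sin θ : ℂ)) ^ 2 + (Real.cos θ : ℂ) ^ 2 = 1 := by exact_mod_cast this
    linear_combination h
  have hD : (1 - ((Real.cos θ / 2 : ℂ) • (Z + star Z)) * ((Real.cos θ / 2 : ℂ) • (Z + star Z)))
      = ((1 + Real.sin θ) ^ 2 / 4 : ℂ) • ((1 + q ^ 2) • 1 - q • (Z ^ 2 + star Z ^ 2)) := by
    have hT : (Z + star Z) * (Z + star Z) = (Z ^ 2 + star Z ^ 2) + (2 : ℂ) • 1 := by
      rw [mul_add, add_mul, add_mul, hZZ, hZZ', sq, sq, two_smul]; abel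
    rw [smul_mul_smul_comm, hT, smul_add, smul_smul, smul_sub, smul_smul, smul_smul]
    have e1 : (Real.cos θ / 2 : ℂ) * (Real.cos θ / 2)
        = (1 + Real.sin θ) ^ 2 / 4 * q := by
      rw [hq']; field_simp; linear_combination 4 * hc
    have e2 : ((1 + Real.sin θ) ^ 2 / 4 * (1 + q ^ 2) : ℂ)
        = 1 - (1 + Real.sin θ) ^ 2 / 4 * q * 2 := by
      rw [hq']; field_simp; ring
    rw [e1, e2]
    module
  have hF1 : (1 - q • Z ^ 2) * (1 - q • star Z ^ 2)
      = (1 + q ^ 2) • 1 - q • (Z ^ 2 + star Z ^ 2) := by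
    rw [sub_mul, mul_sub, mul_sub, smul_mul_smul_comm, hAB, one_mul, one_mul, mul_one]
    module
  have hF2 : (1 - q • star Z ^ 2) * (1 - q • Z ^ 2)
      = (1 + q ^ 2) • 1 - q • (Z ^ 2 + star Z ^ 2) := by
    rw [sub_mul, mul_sub, mul_sub, smul_mul_smul_comm, hBA, one_mul, one_mul, mul_one]
    module
  have hE : (W + star W - 1) * ((1 + q ^ 2) • 1 - q • (Z ^ 2 + star Z ^ 2)) = (1 - q ^ 2) • 1 := by
    have hW1 : W * ((1 + q ^ 2) • 1 - q • (Z ^ 2 + star Z ^ 2)) = 1 - q • star Z ^ 2 := by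
      rw [← hF1, ← mul_assoc, h1, one_mul]
    have hW2 : star W * ((1 + q ^ 2) • 1 - q • (Z ^ 2 + star Z ^ 2)) = 1 - q • Z ^ 2 := by
      rw [← hF2, ← mul_assoc, h2, one_mul]
    rw [sub_mul, add_mul, one_mul, hW1, hW2]
    module
  rw [poissonOp, hD, smul_mul_smul_comm, hE, smul_smul]
  have : (Real.sin θ : ℂ)⁻¹ * ((1 + Real.sin θ) ^ 2 / 4) * (1 - q ^ 2) = 1 := by
    rw [hq']; field_simp; ring
  rw [this, one_smul]

theorem inner_siteTranslate_localizedState {n : ℤ} (hn : n ≠ 0) (x : ℤ) (χ χ' : CoinSpace) :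
    inner ℂ (localizedState x χ) (siteTranslate n (localizedState x χ')) = 0 := by
  rw [inner_localizedState_left, siteTranslate_apply, localizedState_apply_ne (by omega),
    inner_zero_right]

theorem phaseShift_pow (n : ℕ) :
    phaseShift α ^ n = Complex.exp (Complex.I * α) ^ n • siteTranslate n := by
  induction n with
  | zero => simp [siteTranslate_zero]
  | succ n ih =>
    rw [pow_succ, ih, phaseShift, smul_mul_smul_comm, siteTranslate_mul, ← pow_succ]
    push_cast
    rfl

theorem inner_phaseShift_pow {n : ℕ} (hn : n ≠ 0) (x : ℤ) (χ χ' : CoinSpace) :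
    inner ℂ (localizedState x χ) ((phaseShift α ^ n) (localizedState x χ')) = 0 := by
  rw [phaseShift_pow, smul_apply, inner_smul_right,
    inner_siteTranslate_localizedState (by exact_mod_cast hn), mul_zero]

theorem inner_localizedState (x : ℤ) (χ χ' : CoinSpace) :
    inner ℂ (localizedState x χ) (localizedState x χ') = inner ℂ χ χ' := by
  rw [inner_localizedState_left, localizedState_apply_self]

/-- Every term of the series moves the walker by 2n + 2 > 0 sites, away from x. -/
theorem inner_phaseShift_sq_poissonHalf (hs : 0 < Real.sin θ) (x : ℤ) (χ χ' : CoinSpace) :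
    inner ℂ (localizedState x χ)
      ((phaseShift α ^ 2 * poissonHalf θ α) (localizedState x χ')) = 0 := by
  have h := (summable_geometric_of_norm_lt_one (norm_poissonRatio_smul_lt_one α hs)).hasSum
  have h2 := h.mul_left (phaseShift α ^ 2)
  refine (h2.inner_apply _ _).unique ?_
  convert hasSum_zero using 2 with n
  rw [smul_pow, mul_smul_comm, ← pow_mul, ← pow_add, smul_apply, inner_smul_right,
    inner_phaseShift_pow α (by omega), mul_zero]

theorem inner_poissonHalf (hs : 0 < Real.sin θ) (x : ℤ) (χ χ' : CoinSpace) :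
    inner ℂ (localizedState x χ) (poissonHalf θ α (localizedState x χ')) = inner ℂ χ χ' := by
  have h : poissonHalf θ α
      = 1 + (poissonRatio θ : ℂ) • (phaseShift α ^ 2 * poissonHalf θ α) := by
    rw [← mul_poissonHalf α hs, sub_mul, one_mul, smul_mul_assoc, sub_add_cancel]
  rw [h, add_apply, inner_add_right, smul_apply, inner_smul_right,
    inner_phaseShift_sq_poissonHalf α hs, mul_zero, add_zero, one_apply_eq_self,
    inner_localizedState]

/-- From W = 1 + q Z² W one gets Z*² W = Z*² + q W, and only the zeroth term of q W stays at x. -/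
theorem inner_star_phaseShift_sq_poissonHalf (hs : 0 < Real.sin θ) (x : ℤ) (χ χ' : CoinSpace) :
    inner ℂ (localizedState x χ)
      ((star (phaseShift α) ^ 2 * poissonHalf θ α) (localizedState x χ'))
      = poissonRatio θ * inner ℂ χ χ' := by
  have hBA : star (phaseShift α) ^ 2 * phaseShift α ^ 2 = 1 := by
    rw [sq, sq, mul_assoc, ← mul_assoc (star (phaseShift α)) (phaseShift α),
      star_phaseShift_mul_self, one_mul, star_phaseShift_mul_self]
  have h : star (phaseShift α) ^ 2 * poissonHalf θ α
      = star (phaseShift α) ^ 2 + (poissonRatio θ : ℂ) • poissonHalf θ α := by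
    have h0 : poissonHalf θ α
        = 1 + (poissonRatio θ : ℂ) • (phaseShift α ^ 2 * poissonHalf θ α) := by
      rw [← mul_poissonHalf α hs, sub_mul, one_mul, smul_mul_assoc, sub_add_cancel]
    conv_lhs => rw [h0]
    rw [mul_add, mul_one, mul_smul_comm, ← mul_assoc, hBA, one_mul]
  have hB : inner ℂ (localizedState x χ) ((star (phaseShift α) ^ 2) (localizedState x χ')) = 0 := by
    rw [← star_pow, ContinuousLinearMap.star_eq_adjoint, ContinuousLinearMap.adjoint_inner_right,
      ← inner_conj_symm, inner_phaseShift_pow α two_ne_zero, map_zero]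
  rw [h, add_apply, inner_add_right, smul_apply, inner_smul_right, inner_poissonHalf α hs, hB,
    zero_add]

theorem inner_star_apply (K : WalkSpace →L[ℂ] WalkSpace) (Φ Ψ : WalkSpace) :
    inner ℂ Φ (star K Ψ) = (starRingEnd ℂ) (inner ℂ Ψ (K Φ)) := by
  rw [ContinuousLinearMap.star_eq_adjoint, ContinuousLinearMap.adjoint_inner_right,
    inner_conj_symm]

theorem inner_poissonOp (hs : 0 < Real.sin θ) (x : ℤ) (χ χ' : CoinSpace) :
    inner ℂ (localizedState x χ) (poissonOp θ α (localizedState x χ'))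
      = (Real.sin θ : ℂ)⁻¹ * inner ℂ χ χ' := by
  rw [poissonOp, smul_apply, inner_smul_right, sub_apply, add_apply, inner_sub_right,
    inner_add_right, inner_poissonHalf α hs, inner_star_apply, inner_poissonHalf α hs,
    inner_conj_symm, one_apply_eq_self, inner_localizedState, add_sub_cancel_right]

theorem inner_phaseShift_sq_poissonOp (hs : 0 < Real.sin θ) (x : ℤ) (χ χ' : CoinSpace) :
    inner ℂ (localizedState x χ) ((phaseShift α ^ 2 * poissonOp θ α) (localizedState x χ'))
      = (Real.sin θ : ℂ)⁻¹ * (poissonRatio θ * inner ℂ χ χ') := by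
  have h : phaseShift α ^ 2 * star (poissonHalf θ α)
      = star (star (phaseShift α) ^ 2 * poissonHalf θ α) := by
    rw [star_mul, star_pow, star_star]
    exact ((commute_star_poissonHalf α hs ((star_phaseShift_mul_self α).trans
      (phaseShift_mul_star_self α).symm)).pow_right 2).eq.symm
  rw [poissonOp, mul_smul_comm, smul_apply, inner_smul_right, mul_sub, mul_add, mul_one, sub_apply,
    add_apply, inner_sub_right, inner_add_right, inner_phaseShift_sq_poissonHalf α hs, h,
    inner_star_apply, inner_star_phaseShift_sq_poissonHalf α hs,
    inner_phaseShift_pow α two_ne_zero, map_mul, inner_conj_symm, Complex.conj_ofReal]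
  ring

theorem inner_star_phaseShift_sq_poissonOp (hs : 0 < Real.sin θ) (x : ℤ) (χ χ' : CoinSpace) :
    inner ℂ (localizedState x χ) ((star (phaseShift α) ^ 2 * poissonOp θ α) (localizedState x χ'))
      = (Real.sin θ : ℂ)⁻¹ * (poissonRatio θ * inner ℂ χ χ') := by
  have h : star (phaseShift α) ^ 2 * poissonOp θ α = star (phaseShift α ^ 2 * poissonOp θ α) := by
    rw [star_mul, star_pow, star_poissonOp]
    exact ((commute_poissonOp α hs ((phaseShift_mul_star_self α).trans
      (star_phaseShift_mul_self α).symm) (Commute.refl _)).pow_right 2).eq.symm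
  rw [h, inner_star_apply, inner_phaseShift_sq_poissonOp α hs, map_mul, map_mul, inner_conj_symm,
    Complex.conj_ofReal, map_inv₀, Complex.conj_ofReal]

end Poisson

/-! ### Linear growth of the state derivatives -/

/-- The derivative of `U ^ t Ψ` grows linearly: pulled back by `U ^ t`, it is `t v + o(t)`. -/
def HasGrowthRate (U : ℝ → WalkSpace →L[ℂ] WalkSpace) (s : ℝ) (Ψ v : WalkSpace) : Prop :=
  ∃ e : ℕ → WalkSpace,
    (∀ t, HasDerivAt (fun r => (U r ^ t) Ψ) ((U s ^ t) (e t)) s) ∧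
      Filter.Tendsto (fun t : ℕ => (t : ℝ)⁻¹ • e t) Filter.atTop (nhds v)

theorem HasDerivAt.apply_walkSpace {K : ℝ → WalkSpace →L[ℂ] WalkSpace}
    {K' : WalkSpace →L[ℂ] WalkSpace} {s : ℝ} (h : HasDerivAt K K' s) (Ψ : WalkSpace) :
    HasDerivAt (fun r => K r Ψ) (K' Ψ) s := by
  have h1 := ((ContinuousLinearMap.apply ℂ WalkSpace Ψ).restrictScalars ℝ).hasFDerivAt (x := K s)
  exact h1.comp_hasDerivAt s h

theorem tendsto_inv_smul_of_norm_le {e : ℕ → WalkSpace} {C : ℝ} (h : ∀ t, ‖e t‖ ≤ C) :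
    Filter.Tendsto (fun t : ℕ => (t : ℝ)⁻¹ • e t) Filter.atTop (nhds 0) := by
  have h0 : Filter.Tendsto (fun t : ℕ => (t : ℝ)⁻¹ * C) Filter.atTop (nhds 0) := by
    simpa using tendsto_inv_atTop_nhds_zero_nat.mul_const C
  refine squeeze_zero_norm (fun t => ?_) h0
  rw [norm_smul, norm_inv, Real.norm_natCast]
  exact mul_le_mul_of_nonneg_left (h t) (by positivity)

/-- Pulled back by U^t, the coboundary contributes U^{-t} X U^t Ψ - X Ψ, of norm at most 2‖X‖‖Ψ‖;
division by t leaves only P Ψ. -/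
theorem hasGrowthRate_of_coboundary {U : ℝ → WalkSpace →L[ℂ] WalkSpace} {s : ℝ}
    {P X : WalkSpace →L[ℂ] WalkSpace} (hUU : star (U s) * U s = 1) (hUU' : U s * star (U s) = 1)
    (hP : Commute P (U s)) (hU : HasDerivAt U (U s * P + X * U s - U s * X) s) (Ψ : WalkSpace) :
    HasGrowthRate U s Ψ (P Ψ) := by
  have hinv : ∀ t : ℕ, U s ^ t * star (U s) ^ t = 1 := by
    intro t
    rw [← (show Commute (U s) (star (U s)) from hUU'.trans hUU.symm).mul_pow, hUU', one_pow]
  have hnorm : ∀ (V : WalkSpace →L[ℂ] WalkSpace), star V * V = 1 → ∀ (t : ℕ) Φ,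
      ‖(V ^ t) Φ‖ = ‖Φ‖ := by
    intro V hV t Φ
    induction t with
    | zero => simp
    | succ t ih =>
      rw [pow_succ', mul_apply_eq_comp, ← ih]
      exact ContinuousLinearMap.norm_map_iff_adjoint_comp_self _ |>.2 hV _
  refine ⟨fun t => (t : ℝ) • P Ψ + ((star (U s) ^ t) (X ((U s ^ t) Ψ)) - X Ψ), fun t => ?_, ?_⟩
  · refine ((hU.pow_of_coboundary hP t).apply_walkSpace Ψ).congr_deriv ?_
    have h1 : (U s ^ t) ((star (U s) ^ t) (X ((U s ^ t) Ψ))) = X ((U s ^ t) Ψ) := by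
      rw [← mul_apply_eq_comp, hinv, one_apply_eq_self]
    rw [map_add, map_sub, h1, Nat.cast_smul_eq_nsmul, map_nsmul]
    simp only [sub_apply, add_apply, smul_apply, mul_apply_eq_comp]
    abel
  · have hb : ∀ t : ℕ, ‖(star (U s) ^ t) (X ((U s ^ t) Ψ)) - X Ψ‖ ≤ ‖X‖ * ‖Ψ‖ + ‖X‖ * ‖Ψ‖ := by
      intro t
      refine (norm_sub_le _ _).trans (add_le_add ?_ (X.le_opNorm Ψ))
      rw [hnorm _ (by rw [star_star, hUU']) t, ← hnorm _ hUU t Ψ]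
      exact X.le_opNorm _
    have h := (tendsto_inv_smul_of_norm_le hb).const_add (P Ψ)
    rw [add_zero] at h
    refine h.congr' ?_
    -- The identity t⁻¹ t = 1 fails at t = 0, where the inverse is 0.
    filter_upwards [Filter.eventually_gt_atTop 0] with t ht
    have ht' : (t : ℝ) ≠ 0 := by exact_mod_cast ht.ne'
    rw [smul_add, smul_smul, inv_mul_cancel₀ ht', one_smul]

/-- The growth rates of the two derivatives of the state determine the leading order of the quantum
Fisher information matrix. -/
theorem tendsto_qfiMatrix_walkModel {θ φ β : ℝ} {Ψ : WalkSpace} {v : Fin 2 → WalkSpace}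
    (hΨ : ‖Ψ‖ = 1) (h0 : HasGrowthRate (fun s => walkStep s (φ + β) β) θ Ψ (v 0))
    (h1 : HasGrowthRate (fun s => walkStep θ (s + β) β) φ Ψ (v 1)) :
    (∀ (t : ℕ) (μ : Fin 2), ∃ L, IsSLD (walkModel β t Ψ) ![θ, φ] μ L) ∧
    ∀ μ ν, Filter.Tendsto (fun t : ℕ => qfiMatrix (walkModel β t Ψ) ![θ, φ] μ ν / (t : ℝ) ^ 2)
      Filter.atTop
      (nhds (4 * (inner ℂ (v μ) (v ν) - inner ℂ (v μ) Ψ * inner ℂ Ψ (v ν)).re)) := by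
  obtain ⟨e, he, hev⟩ := h0
  obtain ⟨f, hf, hfv⟩ := h1
  have hn : ∀ (t : ℕ) (Θ : Fin 2 → ℝ), ‖walkState (Θ 0) (Θ 1 + β) β t Ψ‖ = 1 :=
    fun t Θ => by rw [norm_walkState, hΨ]
  have hd : ∀ (t : ℕ) (μ : Fin 2), HasDerivAt (fun s => (fun Θ : Fin 2 → ℝ =>
      walkState (Θ 0) (Θ 1 + β) β t Ψ) (Function.update ![θ, φ] μ s))
      ((walkStep θ (φ + β) β ^ t) (![e t, f t] μ)) (![θ, φ] μ) := by
    intro t μ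
    fin_cases μ
    · simpa [walkState] using he t
    · simpa [walkState] using hf t
  have hl : ∀ μ, Filter.Tendsto (fun t : ℕ => (t : ℝ)⁻¹ • ![e t, f t] μ) Filter.atTop
      (nhds (v μ)) := by
    intro μ
    fin_cases μ
    · exact hev
    · exact hfv
  refine ⟨fun t μ => exists_isSLD_pureState (hn t) (hd t μ), fun μ ν => ?_⟩
  refine (tendsto_re_covariance (star_walkStep_mul_self θ (φ + β) β) (hl μ) (hl ν)).congr
    fun t => ?_
  rw [show walkModel β t Ψ = fun Θ => pureState ((fun Θ : Fin 2 → ℝ =>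
      walkState (Θ 0) (Θ 1 + β) β t Ψ) Θ) from rfl,
    qfiMatrix_pureState (hn t) (hd t)]
  rfl

/-! ### Hermitian and anti-Hermitian parts of the step; the drift -/

theorem star_rightCoin (θ φ : ℝ) : star (rightCoin θ φ)
    = !![(Real.cos θ : ℂ), 0; Complex.exp (Complex.I * φ) * Real.sin θ, 0] := by
  have hcos : (starRingEnd ℂ) (Complex.cos θ) = Complex.cos θ := by
    rw [← Complex.ofReal_cos, Complex.conj_ofReal]
  have hsin : (starRingEnd ℂ) (Complex.sin θ) = Complex.sin θ := by
    rw [← Complex.ofReal_sin, Complex.conj_ofReal]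
  ext i j
  fin_cases i <;> fin_cases j <;>
    simp [rightCoin, Matrix.star_apply, ← Complex.exp_conj, hcos, hsin]

theorem star_leftCoin (θ φ : ℝ) : star (leftCoin θ φ)
    = !![0, -(Complex.exp (-(Complex.I * φ)) * Real.sin θ); 0, (Real.cos θ : ℂ)] := by
  have hcos : (starRingEnd ℂ) (Complex.cos θ) = Complex.cos θ := by
    rw [← Complex.ofReal_cos, Complex.conj_ofReal]
  have hsin : (starRingEnd ℂ) (Complex.sin θ) = Complex.sin θ := by
    rw [← Complex.ofReal_sin, Complex.conj_ofReal]
  ext i j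
  fin_cases i <;> fin_cases j <;>
    simp [leftCoin, Matrix.star_apply, ← Complex.exp_conj, hcos, hsin]

theorem star_walkStep_eq_phaseShift (θ φ β : ℝ) :
    star (walkStep θ (φ + β) β) = phaseShift (φ + β) * onCoin (star (leftCoin θ φ))
      + star (phaseShift (φ + β)) * onCoin (star (rightCoin θ φ)) := by
  rw [walkStep_eq_phaseShift, star_add, star_mul, star_mul, star_onCoin, star_onCoin, star_star,
    (commute_phaseShift_onCoin _ _).eq, (commute_star_phaseShift_onCoin _ _).eq, add_comm]

/-- The right-moving part of twice the anti-Hermitian part of the step. -/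
def sineRight (θ φ : ℝ) : Matrix (Fin 2) (Fin 2) ℂ :=
  !![(Real.cos θ : ℂ), 2 * (Complex.exp (-(Complex.I * φ)) * Real.sin θ); 0, -(Real.cos θ : ℂ)]

/-- The left-moving part of twice the anti-Hermitian part of the step. -/
def sineLeft (θ φ : ℝ) : Matrix (Fin 2) (Fin 2) ℂ :=
  !![-(Real.cos θ : ℂ), 0; -(2 * (Complex.exp (Complex.I * φ) * Real.sin θ)), (Real.cos θ : ℂ)]

/-- The anti-Hermitian part of the step. -/
def sineOp (θ φ β : ℝ) : WalkSpace →L[ℂ] WalkSpace :=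
  (1 / 2 : ℂ) • (phaseShift (φ + β) * onCoin (sineRight θ φ)
    + star (phaseShift (φ + β)) * onCoin (sineLeft θ φ))

theorem walkStep_sub_star (θ φ β : ℝ) :
    walkStep θ (φ + β) β - star (walkStep θ (φ + β) β) = (2 : ℂ) • sineOp θ φ β := by
  have h1 : sineRight θ φ = rightCoin θ φ - star (leftCoin θ φ) := by
    rw [star_leftCoin, rightCoin, sineRight]
    ext i j
    fin_cases i <;> fin_cases j <;> simp
    ring
  have h2 : sineLeft θ φ = leftCoin θ φ - star (rightCoin θ φ) := by
    rw [star_rightCoin, leftCoin, sineLeft]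
    ext i j
    fin_cases i <;> fin_cases j <;> simp
    ring
  rw [sineOp, smul_smul, h1, h2, onCoin_sub, onCoin_sub, star_walkStep_eq_phaseShift,
    walkStep_eq_phaseShift, mul_sub, mul_sub, show (2 * (1 / 2) : ℂ) = 1 by norm_num, one_smul]
  abel

/-- At each momentum the step has determinant one, so by Cayley–Hamilton U + U⁻¹ is its trace, a
scalar on the coin. -/
theorem walkStep_add_star (θ φ β : ℝ) :
    walkStep θ (φ + β) β + star (walkStep θ (φ + β) β)
      = (2 : ℂ) • ((Real.cos θ / 2 : ℂ) • (phaseShift (φ + β) + star (phaseShift (φ + β)))) := by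
  have h1 : rightCoin θ φ + star (leftCoin θ φ) = (Real.cos θ : ℂ) • 1 := by
    rw [star_leftCoin, rightCoin]
    ext i j
    fin_cases i <;> fin_cases j <;> simp
  have h2 : leftCoin θ φ + star (rightCoin θ φ) = (Real.cos θ : ℂ) • 1 := by
    rw [star_rightCoin, leftCoin]
    ext i j
    fin_cases i <;> fin_cases j <;> simp
  have h3 : phaseShift (φ + β) * onCoin (rightCoin θ φ + star (leftCoin θ φ))
      + star (phaseShift (φ + β)) * onCoin (leftCoin θ φ + star (rightCoin θ φ))
      = walkStep θ (φ + β) β + star (walkStep θ (φ + β) β) := by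
    rw [onCoin_add, onCoin_add, star_walkStep_eq_phaseShift, walkStep_eq_phaseShift, mul_add,
      mul_add]
    abel
  rw [← h3, h1, h2, onCoin_smul, onCoin_one, smul_smul, mul_smul_comm, mul_smul_comm, mul_one,
    mul_one, smul_add]
  congr 2 <;> ring

theorem star_sineOp (θ φ β : ℝ) : star (sineOp θ φ β) = -sineOp θ φ β := by
  have h := congrArg star (walkStep_sub_star θ φ β)
  rw [star_sub, star_star, ← neg_sub, walkStep_sub_star, star_smul, ← smul_neg] at h
  have h2 : star (2 : ℂ) = 2 := by simp
  rw [h2] at h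
  exact (smul_right_injective _ (two_ne_zero (α := ℂ)) h).symm

theorem commute_phaseShift_sineOp (θ φ β : ℝ) : Commute (phaseShift (φ + β)) (sineOp θ φ β) :=
  ((((Commute.refl _).mul_right (commute_phaseShift_onCoin _ _)).add_right
    (Commute.mul_right ((phaseShift_mul_star_self _).trans (star_phaseShift_mul_self _).symm)
      (commute_phaseShift_onCoin _ _)))).smul_right _

theorem commute_star_phaseShift_sineOp (θ φ β : ℝ) :
    Commute (star (phaseShift (φ + β))) (sineOp θ φ β) :=
  (((Commute.mul_right ((star_phaseShift_mul_self _).trans (phaseShift_mul_star_self _).symm)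
    (commute_star_phaseShift_onCoin _ _)).add_right
      ((Commute.refl _).mul_right (commute_star_phaseShift_onCoin _ _)))).smul_right _

/-- The rate `a e^{-i(k-α)} + b e^{i(k-α)}` at which a quasi-energy changes. -/
def rateOp (α : ℝ) (a b : ℂ) : WalkSpace →L[ℂ] WalkSpace :=
  a • phaseShift α + b • star (phaseShift α)

theorem commute_rateOp (α : ℝ) (a b : ℂ) {K : WalkSpace →L[ℂ] WalkSpace}
    (h : Commute (phaseShift α) K) (h' : Commute (star (phaseShift α)) K) :
    Commute (rateOp α a b) K :=
  (h.smul_left a).add_left (h'.smul_left b)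

theorem commute_phaseShift_star (α : ℝ) : Commute (phaseShift α) (star (phaseShift α)) :=
  (phaseShift_mul_star_self α).trans (star_phaseShift_mul_self α).symm

/-- The part of a generator that commutes with the step. -/
def driftOp (θ φ β : ℝ) (a b : ℂ) : WalkSpace →L[ℂ] WalkSpace :=
  -(rateOp (φ + β) a b * poissonOp θ (φ + β) * sineOp θ φ β)

section Drift

variable {θ : ℝ} (φ β : ℝ)

/-- Instance of the splitting with T, M, R and g = a Z + b Z*. The factor 4 arises because
`sineRight` and `sineLeft` are twice the coefficients of M, while the anticommutator is to equal 2g.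
-/
theorem hasGrowthRate_driftOp (hs : 0 < Real.sin θ) {U : ℝ → WalkSpace →L[ℂ] WalkSpace} {s : ℝ}
    {A : Matrix (Fin 2) (Fin 2) ℂ} {a b : ℂ} (hUs : U s = walkStep θ (φ + β) β)
    (hU : HasDerivAt U (U s * onCoin A) s)
    (ha : sineRight θ φ * A + A * sineRight θ φ = (4 * a) • 1)
    (hb : sineLeft θ φ * A + A * sineLeft θ φ = (4 * b) • 1) (Ψ : WalkSpace) :
    HasGrowthRate U s Ψ (driftOp θ φ β a b Ψ) := by
  set Z := phaseShift (φ + β) with hZ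
  have hZZ : Commute Z (star Z) := commute_phaseShift_star _
  have hZA : Commute Z (onCoin A) := commute_phaseShift_onCoin _ _
  have hZA' : Commute (star Z) (onCoin A) := commute_star_phaseShift_onCoin _ _
  have hT : ∀ {K : WalkSpace →L[ℂ] WalkSpace}, Commute Z K → Commute (star Z) K →
      Commute ((Real.cos θ / 2 : ℂ) • (Z + star Z)) K := fun h h' => (h.add_left h').smul_left _
  have hZT : Commute Z ((Real.cos θ / 2 : ℂ) • (Z + star Z)) :=
    ((Commute.refl Z).add_right hZZ).smul_right _
  have hZT' : Commute (star Z) ((Real.cos θ / 2 : ℂ) • (Z + star Z)) :=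
    (hZZ.symm.add_right (Commute.refl _)).smul_right _
  have hsum := walkStep_add_star θ φ β
  have hdiff := walkStep_sub_star θ φ β
  have hUT : walkStep θ (φ + β) β
      = (Real.cos θ / 2 : ℂ) • (Z + star Z) + sineOp θ φ β := by
    apply smul_right_injective _ (two_ne_zero (α := ℂ))
    change (2 : ℂ) • _ = (2 : ℂ) • _
    rw [smul_add, ← hsum, ← hdiff, two_smul]
    abel
  have hVT : star (walkStep θ (φ + β) β)
      = (Real.cos θ / 2 : ℂ) • (Z + star Z) - sineOp θ φ β := by
    apply smul_right_injective _ (two_ne_zero (α := ℂ))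
    change (2 : ℂ) • _ = (2 : ℂ) • _
    rw [smul_sub, ← hsum, ← hdiff, two_smul]
    abel
  have hanti : sineOp θ φ β * onCoin A + onCoin A * sineOp θ φ β
      = (2 : ℂ) • rateOp (φ + β) a b := by
    have hmove : onCoin A * (Z * onCoin (sineRight θ φ) + star Z * onCoin (sineLeft θ φ))
        = Z * onCoin (A * sineRight θ φ) + star Z * onCoin (A * sineLeft θ φ) := by
      rw [mul_add, ← mul_assoc, ← mul_assoc, ← hZA.eq, ← hZA'.eq, mul_assoc, mul_assoc,
        ← onCoin_mul, ← onCoin_mul]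
    calc sineOp θ φ β * onCoin A + onCoin A * sineOp θ φ β
        = (1 / 2 : ℂ) • (Z * onCoin (sineRight θ φ * A + A * sineRight θ φ)
          + star Z * onCoin (sineLeft θ φ * A + A * sineLeft θ φ)) := by
          rw [sineOp, smul_mul_assoc, mul_smul_comm, ← hZ, hmove, add_mul, mul_assoc, mul_assoc,
            ← onCoin_mul, ← onCoin_mul, onCoin_add, onCoin_add, mul_add, mul_add, ← smul_add]
          congr 1
          abel
      _ = (2 : ℂ) • rateOp (φ + β) a b := by
          rw [ha, hb, onCoin_smul, onCoin_smul, onCoin_one, mul_smul_comm, mul_smul_comm, mul_one,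
            mul_one, rateOp]
          module
  obtain ⟨X, hX1, hX2⟩ := exists_coboundary_of_anticommutator
    (star_walkStep_mul_self θ (φ + β) β) (walkStep_mul_star_self θ (φ + β) β) hUT hVT
    (hT hZA hZA')
    (commute_poissonOp (φ + β) hs hZT hZT')
    (commute_poissonOp (φ + β) hs (commute_phaseShift_sineOp θ φ β)
      (commute_star_phaseShift_sineOp θ φ β))
    (commute_rateOp (φ + β) a b hZT hZT')
    (commute_rateOp (φ + β) a b (commute_phaseShift_sineOp θ φ β)
      (commute_star_phaseShift_sineOp θ φ β))
    (poissonOp_mul (φ + β) hs) hanti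
  refine hasGrowthRate_of_coboundary (P := driftOp θ φ β a b) (X := X) ?_ ?_ ?_ ?_ Ψ
  · rw [hUs, star_walkStep_mul_self]
  · rw [hUs, walkStep_mul_star_self]
  · rw [hUs]; exact hX1
  · rw [hUs] at hU ⊢
    rw [hX2] at hU
    exact hU

/-- Multiplying out g R M gives coin matrices times R, Z² R or Z*² R, so only the Poisson
coefficients of order 0 and ±2 enter. -/
theorem inner_driftOp (hs : 0 < Real.sin θ) (a b : ℂ) (x : ℤ) (χ : CoinSpace) :
    inner ℂ (localizedState x χ) (driftOp θ φ β a b (localizedState x χ))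
      = -((2 * Real.sin θ : ℂ)⁻¹ *
        ((a * poissonRatio θ + b)
            * inner ℂ χ (Matrix.toEuclideanCLM (n := Fin 2) (𝕜 := ℂ) (sineRight θ φ) χ)
          + (b * poissonRatio θ + a)
            * inner ℂ χ (Matrix.toEuclideanCLM (n := Fin 2) (𝕜 := ℂ) (sineLeft θ φ) χ))) := by
  set Z := phaseShift (φ + β) with hZ
  set R := poissonOp θ (φ + β) with hR
  have hZR : Commute R Z := commute_poissonOp _ hs (Commute.refl _) (commute_phaseShift_star _).symm
  have hZR' : Commute R (star Z) := commute_poissonOp _ hs (commute_phaseShift_star _) (Commute.refl _)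
  have hZZ : Z * star Z = 1 := phaseShift_mul_star_self _
  have hZZ' : star Z * Z = 1 := star_phaseShift_mul_self _
  have hexp : rateOp (φ + β) a b * R * sineOp θ φ β = (1 / 2 : ℂ) •
      (a • (Z ^ 2 * R * onCoin (sineRight θ φ)) + b • (R * onCoin (sineRight θ φ))
        + (b • (star Z ^ 2 * R * onCoin (sineLeft θ φ)) + a • (R * onCoin (sineLeft θ φ)))) := by
    have e1 : Z * R * (Z * onCoin (sineRight θ φ)) = Z ^ 2 * R * onCoin (sineRight θ φ) := by
      rw [sq, mul_assoc, ← mul_assoc R, hZR.eq]; simp only [mul_assoc]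
    have e2 : star Z * R * (Z * onCoin (sineRight θ φ)) = R * onCoin (sineRight θ φ) := by
      rw [mul_assoc, ← mul_assoc R, hZR.eq, mul_assoc Z, ← mul_assoc, hZZ', one_mul]
    have e3 : Z * R * (star Z * onCoin (sineLeft θ φ)) = R * onCoin (sineLeft θ φ) := by
      rw [mul_assoc, ← mul_assoc R, hZR'.eq, mul_assoc (star Z), ← mul_assoc, hZZ, one_mul]
    have e4 : star Z * R * (star Z * onCoin (sineLeft θ φ))
        = star Z ^ 2 * R * onCoin (sineLeft θ φ) := by
      rw [sq, mul_assoc, ← mul_assoc R, hZR'.eq]; simp only [mul_assoc]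
    rw [rateOp, sineOp, ← hZ, mul_smul_comm, add_mul, add_mul, mul_add, mul_add]
    simp only [smul_mul_assoc, e1, e2, e3, e4]
    congr 1
    abel
  rw [driftOp, hexp]
  simp only [neg_apply, smul_apply, add_apply, inner_neg_right, inner_smul_right, inner_add_right]
  simp only [mul_apply_eq_comp _ (onCoin _), onCoin_localizedState]
  rw [inner_phaseShift_sq_poissonOp _ hs, inner_star_phaseShift_sq_poissonOp _ hs,
    inner_poissonOp _ hs, inner_poissonOp _ hs]
  rw [mul_inv]
  ring

/-- Here `hab` makes the first rate operator self-adjoint, and R M² = -1 reduces the product of the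
drifts to g g' R. No coin matrix survives, so the result does not depend on the direction of χ. -/
theorem inner_driftOp_driftOp (hs : 0 < Real.sin θ) {a b : ℂ} (hab : star a = b) (c d : ℂ) (x : ℤ)
    (χ : CoinSpace) :
    inner ℂ (driftOp θ φ β a b (localizedState x χ)) (driftOp θ φ β c d (localizedState x χ))
      = (Real.sin θ : ℂ)⁻¹ * ((a * c + b * d) * poissonRatio θ + (a * d + b * c))
        * inner ℂ χ χ := by
  set Z := phaseShift (φ + β) with hZ
  set R := poissonOp θ (φ + β) with hR
  set M := sineOp θ φ β with hM
  have hZM : Commute Z M := commute_phaseShift_sineOp θ φ β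
  have hZM' : Commute (star Z) M := commute_star_phaseShift_sineOp θ φ β
  have hRZ : Commute R Z := commute_poissonOp _ hs (Commute.refl _) (commute_phaseShift_star _).symm
  have hRZ' : Commute R (star Z) := commute_poissonOp _ hs (commute_phaseShift_star _) (Commute.refl _)
  have hRM : Commute R M := commute_poissonOp _ hs hZM hZM'
  have hZZ : Z * star Z = 1 := phaseShift_mul_star_self _
  have hZZ' : star Z * Z = 1 := star_phaseShift_mul_self _
  have hg : star (rateOp (φ + β) a b) = rateOp (φ + β) a b := by
    have hba : star b = a := by rw [← hab, star_star]
    rw [rateOp, star_add, star_smul, star_smul, star_star, hab, hba, add_comm]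
  have hMM : M * M = -(1 - ((Real.cos θ / 2 : ℂ) • (Z + star Z))
      * ((Real.cos θ / 2 : ℂ) • (Z + star Z))) := by
    set T := (Real.cos θ / 2 : ℂ) • (Z + star Z) with hT
    have hTM : Commute T M := (hZM.add_left hZM').smul_left _
    have hUT : walkStep θ (φ + β) β = T + M := by
      apply smul_right_injective _ (two_ne_zero (α := ℂ))
      change (2 : ℂ) • _ = (2 : ℂ) • _
      rw [smul_add, hT, ← walkStep_add_star, hM, ← walkStep_sub_star, two_smul]
      abel
    have hVT : star (walkStep θ (φ + β) β) = T - M := by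
      apply smul_right_injective _ (two_ne_zero (α := ℂ))
      change (2 : ℂ) • _ = (2 : ℂ) • _
      rw [smul_sub, hT, ← walkStep_add_star, hM, ← walkStep_sub_star, two_smul]
      abel
    have h1 := walkStep_mul_star_self θ (φ + β) β
    rw [hUT] at h1 hVT
    rw [hVT] at h1
    rw [← h1, add_mul, mul_sub, mul_sub, hTM.eq]
    abel
  have hRMM : R * (M * M) = -1 := by rw [hMM, mul_neg, poissonOp_mul _ hs]
  have hgR : Commute (rateOp (φ + β) a b) R := commute_rateOp _ _ _ hRZ.symm hRZ'.symm
  have hgM : Commute (rateOp (φ + β) a b) M := commute_rateOp _ _ _ hZM hZM'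
  have hhR : Commute (rateOp (φ + β) c d) R := commute_rateOp _ _ _ hRZ.symm hRZ'.symm
  have hhM : Commute (rateOp (φ + β) c d) M := commute_rateOp _ _ _ hZM hZM'
  have hprod : star (driftOp θ φ β a b) * driftOp θ φ β c d
      = (a * c) • (Z ^ 2 * R) + (b * d) • (star Z ^ 2 * R) + (a * d + b * c) • R := by
    have h1 : star (driftOp θ φ β a b) = rateOp (φ + β) a b * R * M := by
      rw [driftOp, star_neg, star_mul, star_mul, star_sineOp, star_poissonOp, hg, neg_mul, neg_neg,
        ← hM, ← hR, ← hgR.eq]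
      exact ((hgM.mul_left hRM)).eq.symm
    have h2 : rateOp (φ + β) a b * R * M * (rateOp (φ + β) c d * R * M)
        = rateOp (φ + β) a b * rateOp (φ + β) c d * R * (R * (M * M)) := by
      have h3 : M * (rateOp (φ + β) c d * R * M) = rateOp (φ + β) c d * R * (M * M) := by
        rw [← mul_assoc, ← (hhM.mul_left hRM).eq, mul_assoc]
      have h4 : R * (rateOp (φ + β) c d * R * (M * M)) = rateOp (φ + β) c d * R * (R * (M * M)) := by
        rw [← mul_assoc, ← (hhR.mul_left (Commute.refl R)).eq, mul_assoc]
      rw [mul_assoc (rateOp _ a b * R), h3, mul_assoc (rateOp _ a b), h4]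
      simp only [mul_assoc]
    rw [h1, driftOp, mul_neg, ← hM, ← hR, h2, hRMM, mul_neg, mul_one, neg_neg, rateOp, rateOp,
      ← hZ]
    simp only [smul_mul_assoc, mul_smul_comm, hZZ, hZZ', ← sq, add_mul, mul_add, one_mul]
    module
  rw [← ContinuousLinearMap.adjoint_inner_right, ← ContinuousLinearMap.star_eq_adjoint,
    ← mul_apply_eq_comp, hprod]
  simp only [smul_apply, add_apply, inner_smul_right, inner_add_right]
  rw [inner_phaseShift_sq_poissonOp _ hs, inner_star_phaseShift_sq_poissonOp _ hs,
    inner_poissonOp _ hs]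
  ring

end Drift

/-! ### The ballistic case sin θ = 0 -/

/-- The hypotheses give U A U = A, hence U^t A U^t = A. Thus A U^k equals U^{-k} A, and each term of
the product rule contributes an even power of U to the right of A. -/
theorem hasDerivAt_pow_of_anticommuting {𝓐 : Type*} [NormedRing 𝓐] [NormedAlgebra ℝ 𝓐]
    {U : ℝ → 𝓐} {V A : 𝓐} {s : ℝ} (hUV : U s * V = 1) (hA : A * U s = V * A)
    (hU : HasDerivAt U (U s * A) s) (t : ℕ) :
    HasDerivAt (fun r => U r ^ t)
      (U s ^ t * (A * ∑ k ∈ Finset.range t, (U s ^ 2) ^ k)) s := by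
  have hUA : U s * A * U s = A := by rw [mul_assoc, hA, ← mul_assoc, hUV, one_mul]
  have hUAt : ∀ t : ℕ, U s ^ t * A * U s ^ t = A := by
    intro t
    induction t with
    | zero => simp
    | succ t ih =>
      calc U s ^ (t + 1) * A * U s ^ (t + 1) = (U s ^ t * U s) * A * (U s * U s ^ t) := by
            rw [← pow_succ (U s) t, ← pow_succ' (U s) t]
        _ = U s ^ t * (U s * A * U s) * U s ^ t := by simp only [mul_assoc]
        _ = A := by rw [hUA, ih]
  induction t with
  | zero => simpa using hasDerivAt_const s (1 : 𝓐)
  | succ t ih =>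
    refine ((hU.mul ih).congr_deriv ?_).congr_of_eventuallyEq
      (Filter.Eventually.of_forall fun r => pow_succ' (U r) t)
    have h : U s ^ (t + 1) * (A * (U s ^ 2) ^ t) = U s * A * U s ^ t := by
      calc U s ^ (t + 1) * (A * (U s ^ 2) ^ t)
          = U s * (U s ^ t * A * U s ^ t) * U s ^ t := by
            rw [← pow_mul, two_mul, pow_add _ t t, pow_succ' (U s) t]; simp only [mul_assoc]
        _ = _ := by rw [hUAt]
    rw [Finset.sum_range_succ, mul_add, mul_add, h, pow_succ' (U s) t]
    simp only [mul_assoc]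
    abel

section Ballistic

variable {θ : ℝ} (φ β : ℝ)

theorem walkStep_apply_of_sin_eq_zero (hs : Real.sin θ = 0) (Ψ : WalkSpace) (x : ℤ) :
    walkStep θ (φ + β) β Ψ x 0
        = Complex.exp (Complex.I * (φ + β : ℝ)) * Real.cos θ * Ψ (x - 1) 0 ∧
      walkStep θ (φ + β) β Ψ x 1
        = Complex.exp (-(Complex.I * (φ + β : ℝ))) * Real.cos θ * Ψ (x + 1) 1 := by
  have hs' : Complex.sin θ = 0 := by rw [← Complex.ofReal_sin, hs, Complex.ofReal_zero]
  have hadd : ∀ (Φ Φ' : WalkSpace) (y : ℤ), (Φ + Φ') y = Φ y + Φ' y := fun _ _ _ => rfl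
  have hsmul : ∀ (a : ℂ) (Φ : WalkSpace) (y : ℤ), (a • Φ) y = a • Φ y := fun _ _ _ => rfl
  rw [walkStep_eq_phaseShift, star_phaseShift, phaseShift]
  constructor <;>
    simp [hadd, hsmul, onCoin_apply, siteTranslate_apply, rightCoin, leftCoin, hs', Matrix.mulVec,
      dotProduct, Fin.sum_univ_two, Matrix.ofLp_toEuclideanCLM, mul_assoc]

theorem walkStep_pow_apply_eq_zero (hs : Real.sin θ = 0) (x₀ : ℤ) (χ : CoinSpace) (t : ℕ) (x : ℤ) :
    (x ≠ x₀ + t → (walkStep θ (φ + β) β ^ t) (localizedState x₀ χ) x 0 = 0) ∧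
      (x ≠ x₀ - t → (walkStep θ (φ + β) β ^ t) (localizedState x₀ χ) x 1 = 0) := by
  induction t generalizing x with
  | zero => constructor <;> intro h <;> simp at h <;> simp [localizedState_apply_ne h]
  | succ t ih =>
    rw [pow_succ', mul_apply_eq_comp, (walkStep_apply_of_sin_eq_zero φ β hs _ x).1,
      (walkStep_apply_of_sin_eq_zero φ β hs _ x).2]
    simp only [Nat.cast_add, Nat.cast_one]
    constructor <;> intro h
    · rw [(ih (x - 1)).1 (by omega), mul_zero]
    · rw [(ih (x + 1)).2 (by omega), mul_zero]

/-- At time m component 0 lives only at x₀ + m and component 1 only at x₀ - m, so different times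
have disjoint supports. -/
theorem inner_walkStep_pow_eq_zero (hs : Real.sin θ = 0) (x₀ : ℤ) (χ : CoinSpace) {m n : ℕ}
    (hmn : m ≠ n) :
    inner ℂ ((walkStep θ (φ + β) β ^ m) (localizedState x₀ χ))
      ((walkStep θ (φ + β) β ^ n) (localizedState x₀ χ)) = 0 := by
  rw [lp.inner_eq_tsum]
  refine (tsum_congr fun x => ?_).trans tsum_zero
  have hm := walkStep_pow_apply_eq_zero φ β hs x₀ χ m x
  have hn := walkStep_pow_apply_eq_zero φ β hs x₀ χ n x
  rw [PiLp.inner_apply, Fin.sum_univ_two]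
  have h0 : inner ℂ ((walkStep θ (φ + β) β ^ m) (localizedState x₀ χ) x 0)
      ((walkStep θ (φ + β) β ^ n) (localizedState x₀ χ) x 0) = 0 := by
    by_cases h : x = x₀ + m
    · rw [hn.1 (by omega), inner_zero_right]
    · rw [hm.1 h, inner_zero_left]
  have h1 : inner ℂ ((walkStep θ (φ + β) β ^ m) (localizedState x₀ χ) x 1)
      ((walkStep θ (φ + β) β ^ n) (localizedState x₀ χ) x 1) = 0 := by
    by_cases h : x = x₀ - m
    · rw [hn.2 (by omega), inner_zero_right]
    · rw [hm.2 h, inner_zero_left]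
  rw [h0, h1, add_zero]

theorem norm_sum_walkStep_pow (hs : Real.sin θ = 0) (x₀ : ℤ) {χ : CoinSpace} (hχ : ‖χ‖ = 1)
    (t : ℕ) : ‖(∑ k ∈ Finset.range t, (walkStep θ (φ + β) β ^ 2) ^ k) (localizedState x₀ χ)‖ ^ 2
      = t := by
  induction t with
  | zero => simp
  | succ t ih =>
    have horth : inner ℂ ((∑ k ∈ Finset.range t, (walkStep θ (φ + β) β ^ 2) ^ k)
        (localizedState x₀ χ)) (((walkStep θ (φ + β) β ^ 2) ^ t) (localizedState x₀ χ)) = 0 := by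
      rw [sum_apply, sum_inner]
      refine Finset.sum_eq_zero fun k hk => ?_
      rw [← pow_mul, ← pow_mul]
      have := Finset.mem_range.1 hk
      exact inner_walkStep_pow_eq_zero φ β hs x₀ χ (by omega)
    have hnorm : ‖((walkStep θ (φ + β) β ^ 2) ^ t) (localizedState x₀ χ)‖ = 1 := by
      rw [← pow_mul, ← hχ, ← norm_localizedState x₀ χ]
      exact norm_walkState θ (φ + β) β (2 * t) _
    rw [Finset.sum_range_succ, add_apply, norm_add_sq (𝕜 := ℂ), ih, horth, hnorm]
    simp

/-- The generator is off-diagonal and swaps the movers, so A U = U* A. The derivative is then A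
applied to a sum of t orthonormal vectors, of norm O(√t). -/
theorem hasGrowthRate_theta_of_sin_eq_zero (hs : Real.sin θ = 0) (x₀ : ℤ) {χ : CoinSpace}
    (hχ : ‖χ‖ = 1) :
    HasGrowthRate (fun s => walkStep s (φ + β) β) θ (localizedState x₀ χ) 0 := by
  have hs' : Complex.sin θ = 0 := by rw [← Complex.ofReal_sin, hs, Complex.ofReal_zero]
  have hA : onCoin (thetaGenerator φ) * walkStep θ (φ + β) β
      = star (walkStep θ (φ + β) β) * onCoin (thetaGenerator φ) := by
    have hl : thetaGenerator φ * leftCoin θ φ = star (rightCoin θ φ) * thetaGenerator φ := by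
      rw [star_rightCoin, thetaGenerator, leftCoin]
      ext i j
      fin_cases i <;> fin_cases j <;> simp [hs', mul_comm]
    have hr : thetaGenerator φ * rightCoin θ φ = star (leftCoin θ φ) * thetaGenerator φ := by
      rw [star_leftCoin, thetaGenerator, rightCoin]
      ext i j
      fin_cases i <;> fin_cases j <;> simp [hs', mul_comm]
    rw [walkStep_eq_phaseShift, ← walkStep_eq_phaseShift, star_walkStep_eq_phaseShift,
      walkStep_eq_phaseShift, mul_add, add_mul, ← mul_assoc, ← mul_assoc,
      ← (commute_phaseShift_onCoin _ _).eq, ← (commute_star_phaseShift_onCoin _ _).eq]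
    simp only [mul_assoc, ← onCoin_mul, hl, hr]
  refine ⟨fun t => onCoin (thetaGenerator φ)
    ((∑ k ∈ Finset.range t, (walkStep θ (φ + β) β ^ 2) ^ k) (localizedState x₀ χ)),
    fun t => ?_, ?_⟩
  · exact (hasDerivAt_pow_of_anticommuting (U := fun s => walkStep s (φ + β) β)
      (walkStep_mul_star_self θ (φ + β) β) hA (hasDerivAt_walkStep_theta θ φ β) t).apply_walkSpace _
  · have hb : ∀ t : ℕ, ‖(∑ k ∈ Finset.range t, (walkStep θ (φ + β) β ^ 2) ^ k)
        (localizedState x₀ χ)‖ = √t := fun t => by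
      rw [← norm_sum_walkStep_pow φ β hs x₀ hχ t, Real.sqrt_sq (norm_nonneg _)]
    have h0 : Filter.Tendsto (fun t : ℕ => ‖onCoin (thetaGenerator φ)‖ * (√(t : ℝ))⁻¹)
        Filter.atTop (nhds 0) := by
      have := (tendsto_inv_atTop_zero.comp
        (Real.tendsto_sqrt_atTop.comp (tendsto_natCast_atTop_atTop (R := ℝ)))).const_mul
        ‖onCoin (thetaGenerator φ)‖
      simpa using this
    refine squeeze_zero_norm (fun t => ?_) h0
    rw [norm_smul, norm_inv, Real.norm_natCast]
    calc (t : ℝ)⁻¹ * _ ≤ (t : ℝ)⁻¹ * (‖onCoin (thetaGenerator φ)‖ * √t) := by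
          refine mul_le_mul_of_nonneg_left ?_ (by positivity)
          rw [← hb t]
          exact (onCoin (thetaGenerator φ)).le_opNorm _
      _ = ‖onCoin (thetaGenerator φ)‖ * (√t)⁻¹ := by
          rw [mul_left_comm, ← Real.sqrt_div_self, div_eq_mul_inv, mul_comm (√(t : ℝ))]

/-- Generator and step are both diagonal in the coin, so they commute and the coboundary is zero. -/
theorem hasGrowthRate_phi_of_sin_eq_zero (hs : Real.sin θ = 0) (Ψ : WalkSpace) :
    HasGrowthRate (fun s => walkStep θ (s + β) β) φ Ψ (onCoin (phiGenerator θ φ) Ψ) := by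
  have hs' : Complex.sin θ = 0 := by rw [← Complex.ofReal_sin, hs, Complex.ofReal_zero]
  refine hasGrowthRate_of_coboundary (U := fun s => walkStep θ (s + β) β) (s := φ) (X := 0)
    (star_walkStep_mul_self θ (φ + β) β)
    (walkStep_mul_star_self θ (φ + β) β) ?_ ?_ Ψ
  · have hl : Commute (phiGenerator θ φ) (leftCoin θ φ) := by
      rw [Commute, SemiconjBy, phiGenerator, leftCoin]
      ext i j
      fin_cases i <;> fin_cases j <;> simp [hs', mul_comm]
    have hr : Commute (phiGenerator θ φ) (rightCoin θ φ) := by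
      rw [Commute, SemiconjBy, phiGenerator, rightCoin]
      ext i j
      fin_cases i <;> fin_cases j <;> simp [hs', mul_comm]
    have hon : ∀ {A B : Matrix (Fin 2) (Fin 2) ℂ}, Commute A B → Commute (onCoin A) (onCoin B) := by
      intro A B h
      rw [Commute, SemiconjBy, ← onCoin_mul, ← onCoin_mul, h.eq]
    rw [walkStep_eq_phaseShift]
    exact ((commute_phaseShift_onCoin _ _).symm.mul_right (hon hr)).add_right
      ((commute_star_phaseShift_onCoin _ _).symm.mul_right (hon hl))
  · simpa using hasDerivAt_walkStep_phi θ φ β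

end Ballistic

/-! ### Bloch vectors and the explicit growth rates -/

theorem blochVector_coe (χ : CoinSpace) :
    ((blochVector χ 0 : ℝ) : ℂ) = star (χ 0) * χ 1 + star (χ 1) * χ 0 ∧
    ((blochVector χ 1 : ℝ) : ℂ) = -Complex.I * (star (χ 0) * χ 1 - star (χ 1) * χ 0) ∧
    ((blochVector χ 2 : ℝ) : ℂ) = star (χ 0) * χ 0 - star (χ 1) * χ 1 := by
  refine ⟨?_, ?_, ?_⟩ <;>
  · rw [Complex.ext_iff]
    simp [blochVector, pauli, Matrix.trace, Matrix.mul_apply, Matrix.vecMulVec_apply,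
      Fin.sum_univ_two]
    try constructor
    all_goals ring

theorem inner_toEuclideanCLM (χ : CoinSpace) (A : Matrix (Fin 2) (Fin 2) ℂ) :
    inner ℂ χ (Matrix.toEuclideanCLM (n := Fin 2) (𝕜 := ℂ) A χ)
      = star (χ 0) * (A 0 0 * χ 0 + A 0 1 * χ 1) + star (χ 1) * (A 1 0 * χ 0 + A 1 1 * χ 1) := by
  rw [PiLp.inner_apply, Fin.sum_univ_two]
  simp [Matrix.ofLp_toEuclideanCLM, Matrix.mulVec, dotProduct, Fin.sum_univ_two, mul_comm]

theorem cexp_I_mul (φ : ℝ) :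
    Complex.exp (Complex.I * φ) = Real.cos φ + Complex.I * Real.sin φ := by
  rw [mul_comm, Complex.exp_mul_I]; push_cast; ring

theorem cexp_neg_I_mul (φ : ℝ) :
    Complex.exp (-(Complex.I * φ)) = Real.cos φ - Complex.I * Real.sin φ := by
  rw [show -(Complex.I * (φ : ℂ)) = (-φ : ℂ) * Complex.I by ring, Complex.exp_mul_I, Complex.cos_neg,
    Complex.sin_neg]
  push_cast; ring

theorem cross_nHat_two (θ φ : ℝ) (r : Fin 3 → ℝ) :
    crossProduct (nHat θ φ) r 2 = Real.sin θ * (Real.cos φ * r 1 - Real.sin φ * r 0) := by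
  simp [crossProduct, nHat]
  ring

theorem nHat_dotProduct (θ φ : ℝ) (r : Fin 3 → ℝ) :
    nHat θ φ ⬝ᵥ r = Real.sin θ * (Real.cos φ * r 0 + Real.sin φ * r 1) + Real.cos θ * r 2 := by
  simp [nHat, dotProduct, Fin.sum_univ_three]
  ring

/-- The growth rates of the derivatives of the walker's state with respect to `θ` and `φ`. -/
theorem exists_growthRates (θ φ β : ℝ) (hθ : 0 ≤ Real.sin θ) (x₀ : ℤ) {χ : CoinSpace}
    (hχ : ‖χ‖ = 1) :
    ∃ v : Fin 2 → WalkSpace,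
      HasGrowthRate (fun s => walkStep s (φ + β) β) θ (localizedState x₀ χ) (v 0) ∧
      HasGrowthRate (fun s => walkStep θ (s + β) β) φ (localizedState x₀ χ) (v 1) ∧
      inner ℂ (v 0) (v 0) = ((Real.sin θ / (1 + Real.sin θ) : ℝ) : ℂ) ∧
      inner ℂ (v 1) (v 1) = ((1 - Real.sin θ : ℝ) : ℂ) ∧
      inner ℂ (v 0) (v 1) = (0 : ℂ) ∧
      inner ℂ (localizedState x₀ χ) (v 0) = Complex.I *
        ((crossProduct (nHat θ φ) (blochVector χ) 2 / (1 + Real.sin θ) : ℝ) : ℂ) ∧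
      inner ℂ (localizedState x₀ χ) (v 1) = Complex.I *
        ((Real.cos θ * (nHat θ φ ⬝ᵥ blochVector χ) / (1 + Real.sin θ) : ℝ) : ℂ) := by
  have hχχ : inner ℂ χ χ = (1 : ℂ) := by rw [inner_self_eq_norm_sq_to_K, hχ]; simp
  obtain ⟨h0, h1, h2⟩ := blochVector_coe χ
  have hI : Complex.I ^ 2 = -1 := Complex.I_sq
  have hsc : (Real.sin θ : ℂ) ^ 2 + (Real.cos θ : ℂ) ^ 2 = 1 := by
    exact_mod_cast Real.sin_sq_add_cos_sq θ
  have hp : (1 + Real.sin θ : ℂ) ≠ 0 := by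
    have : (1 + Real.sin θ : ℝ) ≠ 0 := by linarith
    exact_mod_cast this
  rcases hθ.eq_or_lt with hs | hs
  · have hs0 : Real.sin θ = 0 := hs.symm
    have hc : (Real.cos θ : ℂ) ^ 2 = 1 := by
      rw [hs0] at hsc; simpa using hsc
    refine ⟨![0, onCoin (phiGenerator θ φ) (localizedState x₀ χ)],
      hasGrowthRate_theta_of_sin_eq_zero φ β hs0 x₀ hχ,
      hasGrowthRate_phi_of_sin_eq_zero φ β hs0 _, ?_, ?_, ?_, ?_, ?_⟩
    · simp [hs0]
    · have hstar : star (phiGenerator θ φ) * phiGenerator θ φ = 1 := by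
        have hcos : (starRingEnd ℂ) (Complex.cos θ) = Complex.cos θ := by
          rw [← Complex.ofReal_cos, Complex.conj_ofReal]
        have hs' : Complex.sin θ = 0 := by rw [← Complex.ofReal_sin, hs0, Complex.ofReal_zero]
        rw [Complex.ofReal_cos] at hc
        ext i j
        fin_cases i <;> fin_cases j <;>
          simp [phiGenerator, Matrix.mul_apply, Matrix.star_apply, Fin.sum_univ_two, hs', hcos]
        all_goals
          linear_combination (-Complex.cos θ ^ 4) * hI + (Complex.cos θ ^ 2 + 1) * hc
      simp only [Matrix.cons_val_one, Matrix.cons_val_fin_one]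
      rw [← ContinuousLinearMap.adjoint_inner_right, ← ContinuousLinearMap.star_eq_adjoint,
        ← mul_apply_eq_comp, star_onCoin, ← onCoin_mul, hstar, onCoin_one, one_apply_eq_self,
        inner_localizedState, hχχ, hs0]
      simp
    · simp
    · simp [cross_nHat_two, hs0]
    · simp only [Matrix.cons_val_one, Matrix.cons_val_fin_one]
      rw [onCoin_localizedState, inner_localizedState, inner_toEuclideanCLM, nHat_dotProduct, hs0]
      push_cast
      rw [h2]
      have hs' : Complex.sin θ = 0 := by rw [← Complex.ofReal_sin, hs0, Complex.ofReal_zero]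
      simp [phiGenerator, hs']
      ring
  · have hs' : (Real.sin θ : ℂ) ≠ 0 := by exact_mod_cast hs.ne'
    have hq : (poissonRatio θ : ℂ) = (1 - Real.sin θ) / (1 + Real.sin θ) := by
      rw [poissonRatio]; push_cast; rfl
    have hpp : Complex.exp (-(Complex.I * φ)) * Complex.exp (Complex.I * φ) = 1 := by
      rw [← Complex.exp_add, neg_add_cancel, Complex.exp_zero]
    -- The coefficients encode g = ∂T for T = cos θ cos(k-α): -sin θ cos(k-α) for θ and cos θ
    -- sin(k-α) for φ.
    refine ⟨![driftOp θ φ β (-Real.sin θ / 2) (-Real.sin θ / 2) (localizedState x₀ χ),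
      driftOp θ φ β (Complex.I * Real.cos θ / 2) (-(Complex.I * Real.cos θ / 2))
        (localizedState x₀ χ)],
      hasGrowthRate_driftOp φ β hs (U := fun s => walkStep s (φ + β) β) rfl
        (hasDerivAt_walkStep_theta θ φ β) ?_ ?_ _,
      hasGrowthRate_driftOp φ β hs (U := fun s => walkStep θ (s + β) β) rfl
        (hasDerivAt_walkStep_phi θ φ β) ?_ ?_ _, ?_, ?_, ?_, ?_, ?_⟩
    · rw [sineRight, thetaGenerator]
      ext i j
      fin_cases i <;> fin_cases j <;> simp
      · linear_combination (-2 * Complex.sin θ) * hpp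
      · ring
      · ring
      · linear_combination (-2 * Complex.sin θ) * hpp
    · rw [sineLeft, thetaGenerator]
      ext i j
      fin_cases i <;> fin_cases j <;> simp
      · linear_combination (-2 * Complex.sin θ) * hpp
      · ring
      · ring
      · linear_combination (-2 * Complex.sin θ) * hpp
    · rw [Complex.ofReal_cos, Complex.ofReal_sin] at hsc
      rw [sineRight, phiGenerator]
      ext i j
      fin_cases i <;> fin_cases j <;> simp
      · linear_combination (2 * Complex.I * Complex.cos θ * Complex.sin θ ^ 2) * hpp
          + (2 * Complex.I * Complex.cos θ) * hsc
      · ring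
      · ring
      · linear_combination (2 * Complex.I * Complex.cos θ * Complex.sin θ ^ 2) * hpp
          + (2 * Complex.I * Complex.cos θ) * hsc
    · rw [Complex.ofReal_cos, Complex.ofReal_sin] at hsc
      rw [sineLeft, phiGenerator]
      ext i j
      fin_cases i <;> fin_cases j <;> simp
      · linear_combination (-2 * Complex.I * Complex.cos θ * Complex.sin θ ^ 2) * hpp
          - (2 * Complex.I * Complex.cos θ) * hsc
      · ring
      · ring
      · linear_combination (-2 * Complex.I * Complex.cos θ * Complex.sin θ ^ 2) * hpp
          - (2 * Complex.I * Complex.cos θ) * hsc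
    · simp only [Matrix.cons_val_zero]
      rw [inner_driftOp_driftOp φ β hs (by simp [-Complex.ofReal_sin]), hχχ, hq]
      push_cast
      push_cast at hs' hp
      field_simp
      ring
    · simp only [Matrix.cons_val_one, Matrix.cons_val_fin_one]
      rw [inner_driftOp_driftOp φ β hs
        (by simp [-Complex.ofReal_cos, neg_div]), hχχ, hq]
      push_cast
      push_cast at hs' hp hsc
      field_simp
      linear_combination (-4 * Complex.sin θ * Complex.cos θ ^ 2) * hI + (4 * Complex.sin θ) * hsc
    · simp only [Matrix.cons_val_zero, Matrix.cons_val_one, Matrix.cons_val_fin_one]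
      -- The coefficients satisfy a = b and d = -c, so both ac + bd and ad + bc vanish.
      rw [inner_driftOp_driftOp φ β hs (by simp [-Complex.ofReal_sin]), hχχ, hq]
      ring
    · simp only [Matrix.cons_val_zero]
      rw [inner_driftOp φ β hs, inner_toEuclideanCLM, inner_toEuclideanCLM, cross_nHat_two, hq]
      push_cast
      rw [h0, h1]
      simp only [sineRight, sineLeft, cexp_I_mul, cexp_neg_I_mul, Matrix.of_apply, Matrix.cons_val',
        Matrix.cons_val_zero, Matrix.cons_val_one, Matrix.cons_val_fin_one]
      push_cast
      push_cast at hs' hp hsc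
      field_simp
      linear_combination (4 * Complex.sin θ * Complex.cos φ *
        (star (χ 0) * χ 1 - χ 0 * star (χ 1))) * hI
    · simp only [Matrix.cons_val_one, Matrix.cons_val_fin_one]
      rw [inner_driftOp φ β hs, inner_toEuclideanCLM, inner_toEuclideanCLM, nHat_dotProduct, hq]
      push_cast
      rw [h0, h1, h2]
      simp only [sineRight, sineLeft, cexp_I_mul, cexp_neg_I_mul, Matrix.of_apply, Matrix.cons_val',
        Matrix.cons_val_zero, Matrix.cons_val_one, Matrix.cons_val_fin_one]
      push_cast
      push_cast at hs' hp hsc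
      field_simp
      ring

theorem re_covariance_eq {v w Ψ : WalkSpace} {g a b : ℝ} (h : inner ℂ v w = (g : ℂ))
    (hv : inner ℂ Ψ v = Complex.I * (a : ℂ)) (hw : inner ℂ Ψ w = Complex.I * (b : ℂ)) :
    (inner ℂ v w - inner ℂ v Ψ * inner ℂ Ψ w).re = g - a * b := by
  rw [h, ← inner_conj_symm v Ψ, hv, hw]
  simp [sub_eq_add_neg]

theorem hasDerivAt_nHat (θ φ : ℝ) : HasDerivAt (fun s : ℝ => nHat s φ)
    ![Real.cos θ * Real.cos φ, Real.cos θ * Real.sin φ, -Real.sin θ] θ := by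
  rw [hasDerivAt_pi]
  intro i
  fin_cases i
  · exact (Real.hasDerivAt_sin θ).mul_const _
  · exact (Real.hasDerivAt_sin θ).mul_const _
  · exact Real.hasDerivAt_cos θ

/-- Every unit vector `(sin η cos φ, sin η sin φ, cos η)` is a Bloch vector. -/
theorem exists_blochVector_eq (η φ : ℝ) : ∃ χ : CoinSpace, ‖χ‖ = 1 ∧
    blochVector χ = ![Real.sin η * Real.cos φ, Real.sin η * Real.sin φ, Real.cos η] := by
  -- The spinor uses half the polar angle.
  obtain ⟨δ, rfl⟩ : ∃ δ, η = 2 * δ := ⟨η / 2, by ring⟩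
  refine ⟨!₂[(Real.cos δ : ℂ), Complex.exp (Complex.I * φ) * Real.sin δ], ?_, ?_⟩
  · rw [EuclideanSpace.norm_eq, Real.sqrt_eq_one, Fin.sum_univ_two]
    have h1 : ‖Complex.exp (Complex.I * φ)‖ = 1 := by
      rw [mul_comm, Complex.norm_exp_ofReal_mul_I]
    simp [h1, -Complex.ofReal_cos, -Complex.ofReal_sin, Complex.norm_real]
  · obtain ⟨h0, h1, h2⟩ := blochVector_coe
      !₂[(Real.cos δ : ℂ), Complex.exp (Complex.I * φ) * Real.sin δ]
    have hstar : star (Complex.exp (Complex.I * φ)) = Complex.exp (-(Complex.I * φ)) := by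
      simp [← Complex.exp_conj]
    have hδ : (Real.sin φ : ℂ) ^ 2 + (Real.cos φ : ℂ) ^ 2 = 1 := by
      exact_mod_cast Real.sin_sq_add_cos_sq φ
    have hI : Complex.I ^ 2 = -1 := Complex.I_sq
    have hstarc : ∀ r : ℝ, star (r : ℂ) = r := Complex.conj_ofReal
    simp only [Matrix.cons_val_zero, Matrix.cons_val_one, Matrix.cons_val_fin_one, star_mul,
      hstar, hstarc] at h0 h1 h2
    rw [Real.sin_two_mul, Real.cos_two_mul']
    ext i
    apply Complex.ofReal_injective
    fin_cases i
    · refine h0.trans ?_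
      rw [cexp_I_mul, cexp_neg_I_mul]
      simp
      ring
    · refine h1.trans ?_
      rw [cexp_I_mul, cexp_neg_I_mul]
      simp
      linear_combination (-2 * Complex.cos δ * Complex.sin δ * Complex.sin φ) * hI
    · refine h2.trans ?_
      rw [cexp_I_mul, cexp_neg_I_mul]
      simp
      rw [Complex.ofReal_sin, Complex.ofReal_cos] at hδ
      linear_combination (-Complex.sin δ ^ 2) * hδ + (Complex.sin δ ^ 2 * Complex.sin φ ^ 2) * hI

end

/-! ### The limits of the Fisher information matrix -/

theorem corollary4 (θ α β φ : ℝ) (hφ : φ = α - β) (hθ : 0 ≤ Real.sin θ) :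
    (∀ (x₀ : ℤ) (χ : CoinSpace), ‖χ‖ = 1 →
      (∀ (t : ℕ) (μ : Fin 2),
        ∃ L, IsSLD (walkModel β t (localizedState x₀ χ)) ![θ, φ] μ L) ∧
      Filter.Tendsto
        (fun t : ℕ => qfiMatrix (walkModel β t (localizedState x₀ χ)) ![θ, φ] 0 0 / (t : ℝ) ^ 2)
        Filter.atTop
        (nhds (4 / (1 + Real.sin θ) *
          (Real.sin θ -
            (crossProduct (nHat θ φ) (blochVector χ) 2) ^ 2 / (1 + Real.sin θ)))) ∧
      Filter.Tendsto
        (fun t : ℕ => qfiMatrix (walkModel β t (localizedState x₀ χ)) ![θ, φ] 1 1 / (t : ℝ) ^ 2)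
        Filter.atTop
        (nhds (4 * (1 - Real.sin θ) *
          (1 - (nHat θ φ ⬝ᵥ blochVector χ) ^ 2 / (1 + Real.sin θ)))) ∧
      (Real.cos θ ≠ 0 →
        Filter.Tendsto
          (fun t : ℕ => qfiMatrix (walkModel β t (localizedState x₀ χ)) ![θ, φ] 0 1 / (t : ℝ) ^ 2)
          Filter.atTop
          (nhds (-4 * (1 - Real.sin θ) / (Real.cos θ * (1 + Real.sin θ)) *
            (nHat θ φ ⬝ᵥ blochVector χ) * crossProduct (nHat θ φ) (blochVector χ) 2)))) ∧
    (∃ χ : CoinSpace, ‖χ‖ = 1 ∧ blochVector χ = deriv (fun s : ℝ => nHat s φ) θ) ∧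
    (∀ (x₀ : ℤ) (χ : CoinSpace), ‖χ‖ = 1 →
      blochVector χ = deriv (fun s : ℝ => nHat s φ) θ →
      Filter.Tendsto
        (fun t : ℕ => ((t : ℝ) ^ 2)⁻¹ • qfiMatrix (walkModel β t (localizedState x₀ χ)) ![θ, φ])
        Filter.atTop
        (nhds (Matrix.diagonal
          ![4 * Real.sin θ / (1 + Real.sin θ), 4 * (1 - Real.sin θ)]))) := by
  obtain rfl : α = φ + β := by rw [hφ]; ring
  have hp : (1 + Real.sin θ) ≠ 0 := by linarith
  have hsc := Real.sin_sq_add_cos_sq θ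
  refine ⟨fun x₀ χ hχ => ?_, ?_, fun x₀ χ hχ hr => ?_⟩
  · obtain ⟨v, hv0, hv1, h00, h11, h01, h0, h1⟩ := exists_growthRates θ φ β hθ x₀ hχ
    obtain ⟨hsld, hlim⟩ := tendsto_qfiMatrix_walkModel
      ((norm_localizedState x₀ χ).trans hχ) hv0 hv1
    refine ⟨hsld, ?_, ?_, fun hc => ?_⟩
    · convert hlim 0 0 using 2
      rw [re_covariance_eq h00 h0 h0]
      field_simp
    · convert hlim 1 1 using 2
      rw [re_covariance_eq h11 h1 h1]
      field_simp
      linear_combination ((nHat θ φ ⬝ᵥ blochVector χ) ^ 2) * hsc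
    -- The covariance gives -4 cos θ (n·r)(n×r)_z / (1 + sin θ)²; the stated form follows from cos²
    -- θ = (1 - sin θ)(1 + sin θ) after dividing by cos θ.
    · convert hlim 0 1 using 2
      rw [re_covariance_eq (g := 0) (by rw [h01, Complex.ofReal_zero]) h0 h1]
      field_simp
      linear_combination ((nHat θ φ ⬝ᵥ blochVector χ) *
        crossProduct (nHat θ φ) (blochVector χ) 2) * hsc
  · rw [(hasDerivAt_nHat θ φ).deriv]
    -- The θ-derivative of n is n itself at polar angle θ + π/2.
    obtain ⟨χ, hχ, hb⟩ := exists_blochVector_eq (θ + Real.pi / 2) φ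
    refine ⟨χ, hχ, ?_⟩
    rw [hb, Real.sin_add_pi_div_two, Real.cos_add_pi_div_two]
  -- The stated off-diagonal formula needs cos θ ≠ 0, so the argument restarts from the growth
  -- rates, valid for all admissible θ. For r = ∂_θ n both overlaps with the initial state vanish.
  · obtain ⟨v, hv0, hv1, h00, h11, h01, h0, h1⟩ := exists_growthRates θ φ β hθ x₀ hχ
    obtain ⟨-, hlim⟩ := tendsto_qfiMatrix_walkModel
      ((norm_localizedState x₀ χ).trans hχ) hv0 hv1
    rw [(hasDerivAt_nHat θ φ).deriv] at hr
    have hcross : crossProduct (nHat θ φ) (blochVector χ) 2 = 0 := by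
      rw [cross_nHat_two, hr]
      simp
      right
      ring
    have hdot : nHat θ φ ⬝ᵥ blochVector χ = 0 := by
      rw [nHat_dotProduct, hr]
      simp
      linear_combination (Real.sin θ * Real.cos θ) * Real.sin_sq_add_cos_sq φ
    rw [hcross] at h0
    rw [hdot] at h1
    have h10 : inner ℂ (v 1) (v 0) = (0 : ℂ) := by rw [← inner_conj_symm, h01, map_zero]
    refine tendsto_pi_nhds.2 fun μ => tendsto_pi_nhds.2 fun ν => ?_
    have hmul : ∀ t : ℕ, (((t : ℝ) ^ 2)⁻¹ •
        qfiMatrix (walkModel β t (localizedState x₀ χ)) ![θ, φ]) μ ν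
        = qfiMatrix (walkModel β t (localizedState x₀ χ)) ![θ, φ] μ ν / (t : ℝ) ^ 2 := by
      intro t
      rw [Matrix.smul_apply, smul_eq_mul, div_eq_inv_mul]
    simp_rw [hmul]
    convert hlim μ ν using 2
    fin_cases μ <;> fin_cases ν
    · refine Eq.trans ?_ (congrArg (4 * ·) (re_covariance_eq h00 h0 h0).symm)
      simp
      ring
    · refine Eq.trans ?_ (congrArg (4 * ·)
        (re_covariance_eq (g := 0) (by rw [h01, Complex.ofReal_zero]) h0 h1).symm)
      simp
    · refine Eq.trans ?_ (congrArg (4 * ·)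
        (re_covariance_eq (g := 0) (by rw [h10, Complex.ofReal_zero]) h1 h0).symm)
      simp
    · refine Eq.trans ?_ (congrArg (4 * ·) (re_covariance_eq h11 h1 h1).symm)
      simp
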